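/- Let $n\ge 2$. For a word $u$ of distinct positive integers, let $\mathrm{red}(u)$ be the word obtained by replacing the $i$-th smallest letter of $u$ by $i$; two words $u,v$ are order-isomorphic if $\mathrm{red}(u)=\mathrm{red}(v)$. For a positive integer $b$ put $c_b(x)=x$ if $x<b$ and $c_b(x)=x+1$ if $x\ge b$. For a word $v=v_1\cdots v_m$ of distinct letters and $1\le i\le m+1$, the $i$-th extension of $v$ is $c_b(v_1)\cdots c_b(v_m)\,b$, where $b$ is the $i$-th smallest letter of $v$ if $i\le m$, and $b=\max_j v_j+1$ if $i=m+1$. The greedy algorithm starts with the word $12\cdots(n-1)$. Given the current word $w=w_1\cdots w_l$, let $i\in\{1,\dots,n\}$ be minimal such that the $i$-th extension of the last $n-1$ letters of $w$ is not order-isomorphic to any factor (block of consecutive letters) of $w$ of length $n$, let $b$ be the last letter of this extension, and replace $w$ by $c_b(w_1)\cdots c_b(w_l)\,b$. If there is no such $i$, the algorithm stops and outputs $w$. Then the algorithm stops, and its (unique) output $\Pi'_n=a_1a_2\cdots$ has length $n!+n-1$. For $1\le k\le n!$ let $\sigma_k=\mathrm{red}(a_ka_{k+1}\cdots a_{k+n-1})$.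 Then $$a_{n!/2+1}=1,\qquad \sigma_{n!/2}=n12\cdots(n-1),\qquad \sigma_{n!/2+1}=134\cdots n2,$$ and, if $n\ge 3$, $\sigma_{n!/2+2}=23\cdots(n-1)1n$. Moreover, $\{\sigma_k: 1\le k\le n!/2\}$ is exactly the set of permutations of $\{1,\dots,n\}$ (in one-line notation) in which $n$ stands before $1$, and $\{\sigma_k: n!/2<k\le n!\}$ is exactly the set of those in which $1$ stands before $n$. -/

import Mathlib

namespace GreedyPerm

/-- The reduced form of a word: every letter is replaced by its rank among the letters of the word
(the `i`-th smallest letter becomes `i`). -/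
def red (u : List ℕ) : List ℕ :=
  u.map fun x => (u.toFinset.filter (· ≤ x)).card

/-- The shift `c_b`: `x` if `x < b`, and `x + 1` if `x ≥ b`. -/
def shift (b x : ℕ) : ℕ := if x < b then x else x + 1

/-- The word `c_b(w₁) c_b(w₂) ⋯ c_b(w_l) b`. -/
def append (w : List ℕ) (b : ℕ) : List ℕ := w.map (shift b) ++ [b]

/-- The last letter `b` of the `i`-th extension (`1 ≤ i ≤ m + 1`) of a word `v` of `m` distinct
letters: the `i`-th smallest letter of `v` if `i ≤ m`, and one more than the largest letter of `v`
if `i = m + 1`. -/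
def extLetter (v : List ℕ) (i : ℕ) : ℕ :=
  if i ≤ v.length then (v.insertionSort (· ≤ ·)).getD (i - 1) 0 else v.foldr max 0 + 1

/-- The `i`-th extension of `v` to the right, `1 ≤ i ≤ v.length + 1`. For `i = v.length + 1` all
letters of `v` are smaller than the new letter `b`, so this is `v` followed by `b`. -/
def extension (v : List ℕ) (i : ℕ) : List ℕ := append v (extLetter v i)

/-- Some factor of length `n` of `w` is order-isomorphic to `p`. -/
def Covers (n : ℕ) (w p : List ℕ) : Prop :=
  ∃ u, u <:+: w ∧ u.length = n ∧ red u = red p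

/-- One step of the greedy algorithm: `i` is minimal such that the `i`-th extension of the last
`n - 1` letters of `w` is order-isomorphic to no factor of `w` of length `n`, and the last letter of
this extension is appended to `w`. -/
def Step (n : ℕ) (w w' : List ℕ) : Prop :=
  ∃ i, IsLeast {i | 1 ≤ i ∧ i ≤ n ∧ ¬ Covers n w (extension (w.rtake (n - 1)) i)} i ∧
    w' = append w (extLetter (w.rtake (n - 1)) i)

/-- `w` is the output of the greedy algorithm: it is reached from `12⋯(n-1)` by greedy steps, and no
further step is possible. -/
def IsOutput (n : ℕ) (w : List ℕ) : Prop :=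
  Relation.ReflTransGen (Step n) (List.range' 1 (n - 1)) w ∧ ¬ ∃ w', Step n w w'

/-- The `k`-th letter of `w`, counted from `1`. -/
def letter (w : List ℕ) (k : ℕ) : Option ℕ := w[k - 1]?

/-- `σ_k`, the reduced form of the factor `a_k a_{k+1} ⋯ a_{k+n-1}` of `w = a_1 a_2 ⋯`. -/
def sigma (n : ℕ) (w : List ℕ) (k : ℕ) : List ℕ := red ((w.drop (k - 1)).take n)

/-- The `n`-permutations, in one-line notation, in which the letter `a` stands before `b`. -/
def permsBefore (n a b : ℕ) : Set (List ℕ) :=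
  {p | p.Perm (List.range' 1 n) ∧ p.idxOf a < p.idxOf b}

end GreedyPerm

/-!
The pattern of a factor of length `n` is an edge of the overlap graph: it joins the pattern of its
first `n - 1` letters to that of its last `n - 1` letters, and the edges leaving a vertex are
labelled `1, …, n` by their last letter. The algorithm is the walk that always leaves along the
smallest unused label. Conservation of flow shows that such a walk can only get stuck at its
starting vertex, and that it has then used all edges at every vertex from which the edges of
largest label lead back to the start; so it visits every permutation once.

The permutations in which `n` stands before `1` carry an initial segment of the labels at every
vertex, and this smaller graph is again balanced with largest-label edges leading to the start.
Hence the greedy walk exhausts it first, and is back at the start `1 2 ⋯ (n - 1)` after `n! / 2`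
steps; this determines the patterns around the middle.
-/

namespace GreedyPerm

open scoped List

section PairSublist

variable {α : Type*} {a b x : α} {l : List α}

theorem pair_sublist_cons_iff : [a, b] <+ x :: l ↔ (a = x ∧ b ∈ l) ∨ [a, b] <+ l := by
  rw [List.sublist_cons_iff, or_comm]
  simp only [List.cons.injEq, and_assoc, exists_and_left, exists_eq_left',
    List.singleton_sublist]

theorem pair_sublist_concat_iff : [a, b] <+ l ++ [x] ↔ (b = x ∧ a ∈ l) ∨ [a, b] <+ l := by
  rw [← List.reverse_sublist, List.reverse_concat', ← List.reverse_sublist (l₂ := l)]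
  simp only [List.reverse_cons, List.reverse_nil, List.nil_append, List.cons_append,
    pair_sublist_cons_iff, List.mem_reverse]

theorem pair_sublist_iff_idxOf_lt [DecidableEq α] (hl : l.Nodup) (hb : b ∈ l) :
    [a, b] <+ l ↔ l.idxOf a < l.idxOf b := by
  induction l with
  | nil => simp at hb
  | cons x l ih =>
    rw [List.nodup_cons] at hl
    rw [pair_sublist_cons_iff]
    rcases eq_or_ne x b with rfl | hxb
    · have : ¬ [a, x] <+ l := fun h => hl.1 (h.subset (by simp))
      simp [hl.1, this]
    · have hbl : b ∈ l := (List.mem_cons.1 hb).resolve_left hxb.symm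
      rcases eq_or_ne x a with rfl | hxa
      · simp [hbl, List.idxOf_cons_ne l hxb]
      · simp [List.idxOf_cons_ne l hxb, List.idxOf_cons_ne l hxa, hxa.symm, ih hl.2 hbl]

theorem not_pair_sublist_iff (hl : l.Nodup) (hab : a ≠ b) (ha : a ∈ l) (hb : b ∈ l) :
    ¬ [a, b] <+ l ↔ [b, a] <+ l := by
  classical
  have hne : l.idxOf a ≠ l.idxOf b := fun h => hab ((List.idxOf_inj ha).1 h)
  rw [pair_sublist_iff_idxOf_lt hl hb, pair_sublist_iff_idxOf_lt hl ha]
  omega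

end PairSublist

theorem filter_lt_getElem {α : Type*} [LinearOrder α] {t : List α} (ht : t.Pairwise (· < ·))
    {k : ℕ} (hk : k < t.length) : t.filter (· < t[k]) = t.take k := by
  induction t generalizing k with
  | nil => simp at hk
  | cons a t ih =>
    rw [List.pairwise_cons] at ht
    cases k with
    | zero => simpa using fun x hx => (ht.1 x hx).le
    | succ k =>
      have hk' : k < t.length := by simpa using hk
      simp [ht.1 _ (List.getElem_mem hk'), ih ht.2 hk']

section Perms

/-- The permutations of `{1, …, n}` in one-line notation. -/
def perms (n : ℕ) : Finset (List ℕ) := (List.range' 1 n).permutations.toFinset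

variable {n x : ℕ} {p q : List ℕ}

theorem mem_perms : p ∈ perms n ↔ p.Perm (List.range' 1 n) := by simp [perms]

theorem range'_mem_perms (n : ℕ) : List.range' 1 n ∈ perms n := mem_perms.2 (List.Perm.refl _)

theorem card_perms (n : ℕ) : (perms n).card = n.factorial := by
  rw [perms, List.toFinset_card_of_nodup (List.nodup_permutations _ List.nodup_range'),
    List.length_permutations, List.length_range']

theorem mem_perms_of_perm (h : q.Perm p) (hp : p ∈ perms n) : q ∈ perms n :=
  mem_perms.2 (h.trans (mem_perms.1 hp))

theorem nodup_of_mem_perms (hp : p ∈ perms n) : p.Nodup :=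
  (mem_perms.1 hp).nodup_iff.2 List.nodup_range'

theorem length_of_mem_perms (hp : p ∈ perms n) : p.length = n := by
  simpa using (mem_perms.1 hp).length_eq

theorem mem_iff_of_mem_perms (hp : p ∈ perms n) : x ∈ p ↔ 1 ≤ x ∧ x ≤ n := by
  rw [(mem_perms.1 hp).mem_iff, List.mem_range'_1]
  omega

theorem mem_perms_of_nodup (hp : p.Nodup) (hlen : p.length = n) (h : ∀ x ∈ p, 1 ≤ x ∧ x ≤ n) :
    p ∈ perms n := by
  refine mem_perms.2 ((List.subperm_of_subset hp fun x hx => ?_).perm_of_length_le (by simp [hlen]))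
  have := h x hx
  rw [List.mem_range'_1]
  omega

end Perms

section Rank

/-- The rank of the letter `x` in the word `u`: the number of letters of `u` that are at most `x`.
Thus `red u` replaces each letter of `u` by its rank. -/
def rank (u : List ℕ) (x : ℕ) : ℕ := (u.toFinset.filter (· ≤ x)).card

variable {u : List ℕ} {x y : ℕ}

theorem red_eq_map (u : List ℕ) : red u = u.map (rank u) := rfl

@[simp] theorem length_red (u : List ℕ) : (red u).length = u.length := by simp [red]

theorem one_le_rank (hx : x ∈ u) : 1 ≤ rank u x :=
  Finset.card_pos.2 ⟨x, by simp [hx]⟩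

theorem rank_le_length (u : List ℕ) (x : ℕ) : rank u x ≤ u.length :=
  (Finset.card_filter_le _ _).trans u.toFinset_card_le

theorem strictMonoOn_rank (u : List ℕ) : StrictMonoOn (rank u) {x | x ∈ u} := by
  refine fun x _ y hy hxy => Finset.card_lt_card ⟨?_, fun h => ?_⟩
  · exact Finset.monotone_filter_right _ fun _ _ hz => hz.trans hxy.le
  · have hyx : y ≤ x :=
      (Finset.mem_filter.1 (h (Finset.mem_filter.2 ⟨by simpa using hy, le_rfl⟩))).2
    exact hyx.not_gt hxy

theorem rank_map {f : ℕ → ℕ} (hf : StrictMonoOn f {x | x ∈ u}) (hx : x ∈ u) :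
    rank (u.map f) (f x) = rank u x := by
  have hinj : Set.InjOn f (u.toFinset.filter (· ≤ x)) := hf.injOn.mono fun y hy =>
    List.mem_toFinset.1 (Finset.mem_filter.1 (Finset.mem_coe.1 hy)).1
  rw [rank, rank, ← Finset.card_image_of_injOn hinj]
  congr 1
  ext z
  simp only [Finset.mem_filter, List.mem_toFinset, List.mem_map, Finset.mem_image]
  constructor
  · rintro ⟨⟨y, hy, rfl⟩, hle⟩
    exact ⟨y, ⟨hy, (hf.le_iff_le hy hx).1 hle⟩, rfl⟩
  · rintro ⟨y, ⟨hy, hle⟩, rfl⟩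
    exact ⟨⟨y, hy, rfl⟩, (hf.le_iff_le hy hx).2 hle⟩

theorem red_map {f : ℕ → ℕ} (hf : StrictMonoOn f {x | x ∈ u}) : red (u.map f) = red u := by
  rw [red_eq_map, red_eq_map, List.map_map]
  exact List.map_congr_left fun x hx => rank_map hf hx

theorem red_map_rank {s : List ℕ} (h : s ⊆ u) : red (s.map (rank u)) = red s :=
  red_map ((strictMonoOn_rank u).mono fun _ hx => h hx)

theorem red_tail_red (u : List ℕ) : red (red u).tail = red u.tail := by
  rw [red_eq_map u, ← List.map_tail, red_map_rank (List.tail_subset u)]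

theorem red_dropLast_red (u : List ℕ) : red (red u).dropLast = red u.dropLast := by
  rw [red_eq_map u, ← List.map_dropLast, red_map_rank (List.dropLast_subset u)]

theorem rank_inj (hx : x ∈ u) (hy : y ∈ u) : rank u x = rank u y ↔ x = y :=
  (strictMonoOn_rank u).injOn.eq_iff hx hy

theorem red_mem_perms (hu : u.Nodup) : red u ∈ perms u.length := by
  refine mem_perms_of_nodup (hu.map_on fun x hx y hy => (rank_inj hx hy).1) (length_red u) ?_
  simp only [red_eq_map, List.mem_map]
  rintro _ ⟨y, hy, rfl⟩
  exact ⟨one_le_rank hy, rank_le_length u y⟩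

theorem red_eq_self {n : ℕ} {p : List ℕ} (hp : p ∈ perms n) : red p = p := by
  refine (List.map_congr_left fun x hx => ?_).trans (List.map_id p)
  have hxn := (mem_iff_of_mem_perms hp).1 hx
  have : p.toFinset.filter (· ≤ x) = Finset.Icc 1 x := by
    ext y
    simp only [Finset.mem_filter, List.mem_toFinset, mem_iff_of_mem_perms hp, Finset.mem_Icc]
    omega
  simp [this]

theorem red_eq_range' (hu : u.Pairwise (· < ·)) : red u = List.range' 1 u.length := by
  have hred : (red u).Pairwise (· < ·) :=
    List.pairwise_map.2 (hu.imp_of_mem fun hx hy hxy => strictMonoOn_rank u hx hy hxy)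
  exact (mem_perms.1 (red_mem_perms (hu.imp ne_of_lt))).eq_of_pairwise'
    hred List.pairwise_lt_range'

theorem rank_eq_length (hu : u.Nodup) (h : ∀ x ∈ u, x ≤ y) : rank u y = u.length := by
  rw [rank, Finset.filter_true_of_mem (by simpa using h), List.toFinset_card_of_nodup hu]

theorem rank_eq_one (hy : y ∈ u) (h : ∀ x ∈ u, y ≤ x) : rank u y = 1 := by
  refine Finset.card_eq_one.2 ⟨y, ?_⟩
  ext x
  simp only [Finset.mem_filter, List.mem_toFinset, Finset.mem_singleton]
  exact ⟨fun hx => le_antisymm hx.2 (h x hx.1), by rintro rfl; exact ⟨hy, le_rfl⟩⟩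

theorem rank_eq_length_sub_one {z : ℕ} (hu : u.Nodup) (hz : z ∈ u) (hyz : y < z)
    (h : ∀ x ∈ u, x ≠ z → x ≤ y) : rank u y = u.length - 1 := by
  have hF : u.toFinset.filter (· ≤ y) = u.toFinset.erase z := by
    ext x
    simp only [Finset.mem_filter, List.mem_toFinset, Finset.mem_erase]
    exact ⟨fun hx => ⟨(hx.2.trans_lt hyz).ne, hx.1⟩, fun hx => ⟨hx.2, h x hx.2 hx.1⟩⟩
  rw [rank, hF, Finset.card_erase_of_mem (by simpa using hz), List.toFinset_card_of_nodup hu]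

end Rank

section Append

variable {m n i x y : ℕ} {v w l : List ℕ}

theorem shift_strictMono (b : ℕ) : StrictMono (shift b) := by
  intro x y h
  unfold shift
  split_ifs <;> omega

theorem shift_ne (b x : ℕ) : shift b x ≠ b := by
  unfold shift
  split_ifs <;> omega

theorem notMem_map_shift (b : ℕ) (w : List ℕ) : b ∉ w.map (shift b) := fun h =>
  let ⟨x, _, hx⟩ := List.mem_map.1 h
  shift_ne b x hx

theorem red_map_shift (b : ℕ) (w : List ℕ) : red (w.map (shift b)) = red w :=
  red_map ((shift_strictMono b).strictMonoOn _)

@[simp] theorem length_append (w : List ℕ) (b : ℕ) : (append w b).length = w.length + 1 := by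
  simp [append]

theorem nodup_append (hw : w.Nodup) (b : ℕ) : (append w b).Nodup := by
  refine List.nodup_append'.2 ⟨hw.map (shift_strictMono b).injective, List.nodup_singleton b, ?_⟩
  exact List.disjoint_singleton.2 (notMem_map_shift b w)

theorem cons_map_shift_perm_append (b : ℕ) (w : List ℕ) :
    (b :: w.map (shift b)).Perm (append w b) :=
  (List.perm_append_singleton b _).symm

theorem append_mem_perms (hv : v ∈ perms m) (h1 : 1 ≤ i) (h2 : i ≤ m + 1) :
    append v i ∈ perms (m + 1) := by
  refine mem_perms_of_nodup (nodup_append (nodup_of_mem_perms hv) i)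
    (by simp [length_of_mem_perms hv]) fun x hx => ?_
  rw [append, List.mem_append, List.mem_map, List.mem_singleton] at hx
  obtain ⟨y, hy, rfl⟩ | rfl := hx
  · have := (mem_iff_of_mem_perms hv).1 hy
    unfold shift
    split_ifs <;> omega
  · exact ⟨h1, h2⟩

theorem map_shift_red (h : i :: l ∈ perms n) : (red l).map (shift i) = l := by
  have hil : i ∉ l := (List.nodup_cons.1 (nodup_of_mem_perms h)).1
  have hmem (y : ℕ) : y ∈ l ↔ y ≠ i ∧ 1 ≤ y ∧ y ≤ n := by
    rw [← mem_iff_of_mem_perms h, List.mem_cons]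
    constructor
    · exact fun hy => ⟨fun e => hil (e ▸ hy), Or.inr hy⟩
    · exact fun hy => hy.2.resolve_left hy.1
  have hi : 1 ≤ i := ((mem_iff_of_mem_perms h).1 (by simp)).1
  rw [red_eq_map, List.map_map]
  refine (List.map_congr_left fun x hx => ?_).trans (List.map_id l)
  have hx' := (hmem x).1 hx
  have hF : l.toFinset.filter (· ≤ x) = (Finset.Icc 1 x).erase i := by
    ext y
    simp only [Finset.mem_filter, List.mem_toFinset, hmem, Finset.mem_erase, Finset.mem_Icc]
    omega
  simp only [Function.comp_apply, rank, hF, Finset.card_erase_eq_ite, Finset.mem_Icc, hi, true_and,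
    Nat.card_Icc, shift, id]
  split_ifs <;> omega

theorem append_red (h : l ++ [x] ∈ perms n) : append (red l) x = l ++ [x] := by
  rw [append, map_shift_red (mem_perms_of_perm (List.perm_append_singleton x l).symm h)]

theorem red_concat (h : (v ++ [y]).Nodup) :
    red (v ++ [y]) = append (red v) (rank (v ++ [y]) y) := by
  have hred := red_mem_perms h
  rw [red_eq_map, List.map_append, List.map_singleton] at hred ⊢
  rw [← append_red hred, red_map_rank (List.subset_append_left v [y])]

theorem rank_append_self (hv : v.Nodup) (b : ℕ) :
    rank (append v b) b = (v.filter (· < b)).length + 1 := by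
  have hF : (append v b).toFinset.filter (· ≤ b) = insert b (v.filter (· < b)).toFinset := by
    ext z
    simp only [append, Finset.mem_filter, List.mem_toFinset, List.mem_append, List.mem_map,
      List.mem_singleton, Finset.mem_insert, List.mem_filter, decide_eq_true_eq, shift]
    constructor
    · rintro ⟨⟨y, hy, rfl⟩ | h, hz⟩
      · right
        split_ifs at hz ⊢ with hyb
        · exact ⟨hy, hyb⟩
        · omega
      · exact Or.inl h
    · rintro (rfl | ⟨hz, hlt⟩)
      · exact ⟨Or.inr rfl, le_rfl⟩
      · exact ⟨Or.inl ⟨z, hz, if_pos hlt⟩, hlt.le⟩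
  rw [rank, hF, Finset.card_insert_of_notMem (by simp),
    List.toFinset_card_of_nodup (hv.filter _)]

end Append

section Extension

variable {i : ℕ} {v : List ℕ}

theorem length_filter_lt_extLetter (hv : v.Nodup) (h1 : 1 ≤ i) (h2 : i ≤ v.length + 1) :
    (v.filter (· < extLetter v i)).length = i - 1 := by
  have hperm : (v.insertionSort (· ≤ ·)).Perm v := List.perm_insertionSort _ v
  by_cases hi : i ≤ v.length
  · have hi' : i - 1 < (v.insertionSort (· ≤ ·)).length := by rw [hperm.length_eq]; omega
    have hsorted : (v.insertionSort (· ≤ ·)).Pairwise (· < ·) :=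
      (List.pairwise_insertionSort (· ≤ ·) v).imp₂ (fun _ _ => lt_of_le_of_ne)
        (hperm.nodup_iff.2 hv)
    rw [extLetter, if_pos hi, List.getD_eq_getElem _ _ hi', ← (hperm.filter _).length_eq,
      filter_lt_getElem hsorted hi', List.length_take]
    omega
  · rw [extLetter, if_neg hi, List.filter_eq_self.2]
    · omega
    · exact fun x hx => decide_eq_true (Nat.lt_succ_of_le (List.le_max_of_le hx le_rfl))

theorem red_extension (hv : v.Nodup) (h1 : 1 ≤ i) (h2 : i ≤ v.length + 1) :
    red (extension v i) = append (red v) i := by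
  have hrank : rank (append v (extLetter v i)) (extLetter v i) = i := by
    rw [rank_append_self hv, length_filter_lt_extLetter hv h1 h2]
    omega
  have hnodup := nodup_append hv (extLetter v i)
  rw [extension]
  rw [append] at hrank hnodup ⊢
  rw [red_concat hnodup, red_map_shift, hrank]

theorem one_le_extLetter (hv : ∀ x ∈ v, 1 ≤ x) (h1 : 1 ≤ i) : 1 ≤ extLetter v i := by
  rw [extLetter]
  split_ifs with hi
  · have hi' : i - 1 < (v.insertionSort (· ≤ ·)).length := by
      rw [List.length_insertionSort]
      omega
    rw [List.getD_eq_getElem _ _ hi']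
    exact hv _ ((List.mem_insertionSort (· ≤ ·)).1 (List.getElem_mem hi'))
  · omega

theorem extLetter_le {N : ℕ} (hv : ∀ x ∈ v, x ≤ N) (i : ℕ) : extLetter v i ≤ N + 1 := by
  rw [extLetter]
  split_ifs with hi
  · rcases lt_or_ge (i - 1) (v.insertionSort (· ≤ ·)).length with hi' | hi'
    · rw [List.getD_eq_getElem _ _ hi']
      exact (hv _ ((List.mem_insertionSort (· ≤ ·)).1 (List.getElem_mem hi'))).trans (by omega)
    · rw [List.getD_eq_default _ _ hi']
      omega
  · exact Nat.succ_le_succ (List.max_le_of_forall_le v N hv)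

end Extension

/-- A directed multigraph with vertices `V` and edges `E` whose edges carry labels in `L`. -/
structure LabelledDigraph (E V L : Type*) where
  src : E → V
  tgt : E → V
  lab : E → L

namespace LabelledDigraph

variable {E V L : Type*} [LinearOrder L]

/-- The edges `s 0, …, s (K - 1)` form a walk through the vertices `ν 0, …, ν K` that uses no edge
twice, stays inside `P`, and at each vertex prefers unused edges of `P` of smaller label. -/
structure IsGreedyWalk (G : LabelledDigraph E V L) (P : Finset E) (s : ℕ → E) (ν : ℕ → V)
    (K : ℕ) : Prop where
  mem : ∀ k < K, s k ∈ P
  src_eq : ∀ k < K, G.src (s k) = ν k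
  tgt_eq : ∀ k < K, G.tgt (s k) = ν (k + 1)
  injOn : Set.InjOn s (Set.Iio K)
  greedy : ∀ k < K, ∀ q ∈ P, G.src q = ν k → G.lab q < G.lab (s k) → ∃ j < k, s j = q

/-- The edges `s 0, …, s (K - 1)` include all edges of `P` leaving `u`. A walk through the vertices
`ν 0, …, ν K` is stuck if it exhausts `ν K`. -/
def Exhausts (G : LabelledDigraph E V L) (P : Finset E) (s : ℕ → E) (K : ℕ) (u : V) : Prop :=
  ∀ p ∈ P, G.src p = u → ∃ k < K, s k = p

/-- Among the edges of `P` leaving `u`, the one with the largest label ends in `v`. -/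
def TopEdge (G : LabelledDigraph E V L) (P : Finset E) (u v : V) : Prop :=
  ∃ q ∈ P, G.src q = u ∧ G.tgt q = v ∧ ∀ p ∈ P, G.src p = u → p ≠ q → G.lab p < G.lab q

/-- The conditions on `P` under which a greedy walk from `r` has to use every edge of `P` before it
gets stuck: no vertex has more incoming than outgoing edges, and following the edges of largest
label leads from every source of an edge to `r`. -/
structure IsGreedyEulerian [DecidableEq V] (G : LabelledDigraph E V L) (P : Finset E) (r : V) :
    Prop where
  card_in_le_card_out : ∀ u, (P.filter (G.tgt · = u)).card ≤ (P.filter (G.src · = u)).card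
  reach : ∀ p ∈ P, Relation.ReflTransGen (G.TopEdge P) (G.src p) r

theorem card_filter_succ_add [DecidableEq V] (ν : ℕ → V) (u : V) (K : ℕ) :
    ((Finset.range K).filter (fun k => ν (k + 1) = u)).card + (if ν 0 = u then 1 else 0) =
      ((Finset.range K).filter (ν · = u)).card + (if ν K = u then 1 else 0) := by
  simp only [Finset.card_filter]
  rw [← Finset.sum_range_succ (fun k => if ν k = u then 1 else 0),
    ← Finset.sum_range_succ' (fun k => if ν k = u then 1 else 0)]

namespace IsGreedyWalk

variable {G : LabelledDigraph E V L} {P Q : Finset E} {s s' : ℕ → E} {ν ν' : ℕ → V} {K T : ℕ}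

theorem congr (h : G.IsGreedyWalk P s ν K) (hs : ∀ k < K, s' k = s k) (hν : ∀ k ≤ K, ν' k = ν k) :
    G.IsGreedyWalk P s' ν' K where
  mem k hk := hs k hk ▸ h.mem k hk
  src_eq k hk := by rw [hs k hk, hν k hk.le, h.src_eq k hk]
  tgt_eq k hk := by rw [hs k hk, hν (k + 1) hk, h.tgt_eq k hk]
  injOn := h.injOn.congr fun k hk => (hs k hk).symm
  greedy k hk q hq hsrc hlab := by
    rw [hν k hk.le] at hsrc
    rw [hs k hk] at hlab
    obtain ⟨j, hj, rfl⟩ := h.greedy k hk q hq hsrc hlab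
    exact ⟨j, hj, hs j (hj.trans hk)⟩

theorem succ (h : G.IsGreedyWalk P s ν K) (hmem : s K ∈ P) (hsrc : G.src (s K) = ν K)
    (htgt : G.tgt (s K) = ν (K + 1)) (hnew : ∀ k < K, s k ≠ s K)
    (hgreedy : ∀ q ∈ P, G.src q = ν K → G.lab q < G.lab (s K) → ∃ j < K, s j = q) :
    G.IsGreedyWalk P s ν (K + 1) where
  mem := Nat.forall_lt_succ_right.2 ⟨h.mem, hmem⟩
  src_eq := Nat.forall_lt_succ_right.2 ⟨h.src_eq, hsrc⟩
  tgt_eq := Nat.forall_lt_succ_right.2 ⟨h.tgt_eq, htgt⟩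
  injOn := by
    rw [← Order.succ_eq_add_one, Order.Iio_succ_eq_insert, Set.injOn_insert (by simp)]
    exact ⟨h.injOn, fun ⟨k, hk, hks⟩ => hnew k hk hks⟩
  greedy := Nat.forall_lt_succ_right.2 ⟨h.greedy, hgreedy⟩

theorem restrict (h : G.IsGreedyWalk P s ν K) (hQP : Q ⊆ P) (hTK : T ≤ K)
    (hQ : ∀ k < T, s k ∈ Q) : G.IsGreedyWalk Q s ν T where
  mem := hQ
  src_eq k hk := h.src_eq k (hk.trans_le hTK)
  tgt_eq k hk := h.tgt_eq k (hk.trans_le hTK)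
  injOn := h.injOn.mono (Set.Iio_subset_Iio hTK)
  greedy k hk q hq := h.greedy k (hk.trans_le hTK) q (hQP hq)

theorem exists_maximal_initial_walk (h : G.IsGreedyWalk P s ν K) (hstuck : G.Exhausts P s K (ν K))
    (hQP : Q ⊆ P) (hlab : ∀ q ∈ Q, ∀ p ∈ P, p ∉ Q → G.src q = G.src p → G.lab q < G.lab p) :
    ∃ T ≤ K, G.IsGreedyWalk Q s ν T ∧ G.Exhausts Q s T (ν T) := by
  classical
  have hex : ∃ T, T = K ∨ s T ∉ Q := ⟨K, Or.inl rfl⟩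
  obtain ⟨T, hTK, hQ, hT⟩ : ∃ T ≤ K, (∀ k < T, s k ∈ Q) ∧ (T = K ∨ T < K ∧ s T ∉ Q) := by
    have hle := Nat.find_min' hex (Or.inl rfl)
    refine ⟨Nat.find hex, hle, fun k hk => ?_, ?_⟩
    · exact not_not.1 (not_or.1 (Nat.find_min hex hk)).2
    · exact hle.eq_or_lt.imp_right fun hlt => ⟨hlt, (Nat.find_spec hex).resolve_left hlt.ne⟩
  refine ⟨T, hTK, h.restrict hQP hTK hQ, fun q hq hsrc => ?_⟩
  rcases hT with rfl | ⟨hlt, hsT⟩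
  · exact hstuck q (hQP hq) hsrc
  · exact h.greedy T hlt q (hQP hq) hsrc
      (hlab q hq (s T) (h.mem T hlt) hsT (hsrc.trans (h.src_eq T hlt).symm))

theorem image_subset [DecidableEq E] (h : G.IsGreedyWalk P s ν K) :
    (Finset.range K).image s ⊆ P := by
  simpa [Finset.image_subset_iff] using h.mem

theorem card_image [DecidableEq E] (h : G.IsGreedyWalk P s ν K) :
    ((Finset.range K).image s).card = K := by
  rw [Finset.card_image_of_injOn (by simpa using h.injOn), Finset.card_range]

theorem length_le_card (h : G.IsGreedyWalk P s ν K) : K ≤ P.card := by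
  classical
  exact h.card_image ▸ Finset.card_le_card h.image_subset

variable [DecidableEq V]

theorem card_image_filter [DecidableEq E] (h : G.IsGreedyWalk P s ν K) (f : E → V) (u : V) :
    (((Finset.range K).image s).filter (f · = u)).card =
      ((Finset.range K).filter (fun k => f (s k) = u)).card := by
  rw [Finset.filter_image, Finset.card_image_of_injOn]
  refine h.injOn.mono fun k hk => ?_
  simpa using (Finset.mem_filter.1 hk).1

theorem card_in_add_eq_card_out_add [DecidableEq E] (h : G.IsGreedyWalk P s ν K) (u : V) :
    (((Finset.range K).image s).filter (G.tgt · = u)).card + (if ν 0 = u then 1 else 0) =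
      (((Finset.range K).image s).filter (G.src · = u)).card + (if ν K = u then 1 else 0) := by
  have hin : (Finset.range K).filter (fun k => G.tgt (s k) = u) =
      (Finset.range K).filter (fun k => ν (k + 1) = u) :=
    Finset.filter_congr fun k hk => by rw [h.tgt_eq k (Finset.mem_range.1 hk)]
  have hout : (Finset.range K).filter (fun k => G.src (s k) = u) =
      (Finset.range K).filter (ν · = u) :=
    Finset.filter_congr fun k hk => by rw [h.src_eq k (Finset.mem_range.1 hk)]
  rw [h.card_image_filter, h.card_image_filter, hin, hout, card_filter_succ_add]

theorem card_out_of_exhausts [DecidableEq E] (h : G.IsGreedyWalk P s ν K) {u : V}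
    (hu : G.Exhausts P s K u) :
    (((Finset.range K).image s).filter (G.src · = u)).card = (P.filter (G.src · = u)).card := by
  congr 1
  refine (Finset.filter_subset_filter _ h.image_subset).antisymm fun p hp => ?_
  obtain ⟨hpP, hpu⟩ := Finset.mem_filter.1 hp
  obtain ⟨k, hk, rfl⟩ := hu p hpP hpu
  exact Finset.mem_filter.2 ⟨Finset.mem_image_of_mem s (Finset.mem_range.2 hk), hpu⟩

theorem last_eq_first (h : G.IsGreedyWalk P s ν K) (hstuck : G.Exhausts P s K (ν K))
    (hbal : ∀ u, (P.filter (G.tgt · = u)).card ≤ (P.filter (G.src · = u)).card) : ν K = ν 0 := by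
  classical
  by_contra hne
  have hflow := h.card_in_add_eq_card_out_add (ν K)
  rw [if_neg (Ne.symm hne), if_pos rfl, h.card_out_of_exhausts hstuck] at hflow
  have hin := Finset.card_le_card
    (Finset.filter_subset_filter (G.tgt · = ν K) h.image_subset)
  have := hbal (ν K)
  omega

/-- By flow conservation, a closed walk that leaves `v` along all edges of `P` has entered `v` along
all edges of `P`, in particular along the edge of largest label at `u`; before using this edge it
has used all others at `u`. -/
theorem exhausts_of_topEdge (h : G.IsGreedyWalk P s ν K) (hclosed : ν K = ν 0)
    (hbal : ∀ u, (P.filter (G.tgt · = u)).card ≤ (P.filter (G.src · = u)).card) {u v : V}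
    (huv : G.TopEdge P u v) (hv : G.Exhausts P s K v) : G.Exhausts P s K u := by
  classical
  obtain ⟨q, hq, rfl, rfl, htop⟩ := huv
  have hin : ((Finset.range K).image s).filter (G.tgt · = G.tgt q) =
      P.filter (G.tgt · = G.tgt q) := by
    refine Finset.eq_of_subset_of_card_le (Finset.filter_subset_filter _ h.image_subset) ?_
    have hflow := h.card_in_add_eq_card_out_add (G.tgt q)
    rw [hclosed, h.card_out_of_exhausts hv, Nat.add_right_cancel_iff] at hflow
    exact hflow ▸ hbal (G.tgt q)
  have hq_in : q ∈ P.filter (G.tgt · = G.tgt q) := Finset.mem_filter.2 ⟨hq, rfl⟩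
  rw [← hin] at hq_in
  obtain ⟨k, hk, rfl⟩ := Finset.mem_image.1 (Finset.mem_filter.1 hq_in).1
  rw [Finset.mem_range] at hk
  intro p hp hsrc
  rcases eq_or_ne p (s k) with rfl | hne
  · exact ⟨k, hk, rfl⟩
  · obtain ⟨j, hj, rfl⟩ := h.greedy k hk p hp (hsrc.trans (h.src_eq k hk)) (htop p hp hsrc hne)
    exact ⟨j, hj.trans hk, rfl⟩

theorem image_eq [DecidableEq E] (h : G.IsGreedyWalk P s ν K) (hstuck : G.Exhausts P s K (ν K))
    (hP : G.IsGreedyEulerian P (ν 0)) : (Finset.range K).image s = P := by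
  have hclosed := h.last_eq_first hstuck hP.card_in_le_card_out
  refine h.image_subset.antisymm fun p hp => ?_
  have hexhausts {u : V} (hu : Relation.ReflTransGen (G.TopEdge P) u (ν 0)) :
      G.Exhausts P s K u := by
    induction hu using Relation.ReflTransGen.head_induction_on with
    | refl => exact hclosed ▸ hstuck
    | head huv _ ih => exact h.exhausts_of_topEdge hclosed hP.card_in_le_card_out huv ih
  obtain ⟨k, hk, rfl⟩ := hexhausts (hP.reach p hp) p hp rfl
  exact Finset.mem_image_of_mem s (Finset.mem_range.2 hk)

theorem length_eq_card (h : G.IsGreedyWalk P s ν K) (hstuck : G.Exhausts P s K (ν K))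
    (hP : G.IsGreedyEulerian P (ν 0)) : K = P.card := by
  classical
  rw [← h.image_eq hstuck hP, h.card_image]

/-- A greedy walk in `P` is a greedy walk in `Q` until it is stuck in `Q`. -/
theorem initial_segment (h : G.IsGreedyWalk P s ν K) (hstuck : G.Exhausts P s K (ν K))
    (hQP : Q ⊆ P) (hlab : ∀ q ∈ Q, ∀ p ∈ P, p ∉ Q → G.src q = G.src p → G.lab q < G.lab p)
    (hQ : G.IsGreedyEulerian Q (ν 0)) :
    ν Q.card = ν 0 ∧ ∀ k < K, s k ∈ Q ↔ k < Q.card := by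
  classical
  obtain ⟨T, hTK, hwalk, hstuckQ⟩ := h.exists_maximal_initial_walk hstuck hQP hlab
  obtain rfl := hwalk.length_eq_card hstuckQ hQ
  refine ⟨hwalk.last_eq_first hstuckQ hQ.card_in_le_card_out, fun k hk => ⟨fun hsk => ?_, ?_⟩⟩
  · rw [← hwalk.image_eq hstuckQ hQ, Finset.mem_image] at hsk
    obtain ⟨j, hj, hjk⟩ := hsk
    rw [Finset.mem_range] at hj
    exact h.injOn (hj.trans_le hTK) hk hjk ▸ hj
  · exact hwalk.mem k

end IsGreedyWalk

end LabelledDigraph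

section MaxBeforeMin

variable {m n i x : ℕ} {p u v : List ℕ}

/-- The permutations of `{1, …, n}` in which `n` stands before `1`. -/
def maxBeforeMin (n : ℕ) : Finset (List ℕ) := (perms n).filter ([n, 1] <+ ·)

theorem mem_maxBeforeMin : p ∈ maxBeforeMin n ↔ p ∈ perms n ∧ [n, 1] <+ p := Finset.mem_filter

theorem maxBeforeMin_subset_perms (n : ℕ) : maxBeforeMin n ⊆ perms n := Finset.filter_subset _ _

theorem permsBefore_max_one (hn : 1 ≤ n) : permsBefore n n 1 = {p | p ∈ maxBeforeMin n} := by
  ext p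
  rw [permsBefore, Set.mem_ofPred_eq, Set.mem_ofPred_eq, mem_maxBeforeMin, ← mem_perms]
  refine and_congr_right fun hp => ?_
  rw [pair_sublist_iff_idxOf_lt (nodup_of_mem_perms hp) ((mem_iff_of_mem_perms hp).2 ⟨le_rfl, hn⟩)]

theorem pair_sublist_comm (hn : 2 ≤ n) (hp : p ∈ perms n) : [1, n] <+ p ↔ ¬ [n, 1] <+ p :=
  (not_pair_sublist_iff (nodup_of_mem_perms hp) (by omega)
    ((mem_iff_of_mem_perms hp).2 (by omega)) ((mem_iff_of_mem_perms hp).2 (by omega))).symm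

theorem permsBefore_one_max (hn : 2 ≤ n) :
    permsBefore n 1 n = {p | p ∈ perms n ∧ p ∉ maxBeforeMin n} := by
  ext p
  rw [permsBefore, Set.mem_ofPred_eq, Set.mem_ofPred_eq, mem_maxBeforeMin, ← mem_perms]
  refine and_congr_right fun hp => ?_
  rw [← pair_sublist_iff_idxOf_lt (nodup_of_mem_perms hp)
    ((mem_iff_of_mem_perms hp).2 (by omega)), pair_sublist_comm hn hp]
  simp only [hp, true_and]

theorem reverse_mem_maxBeforeMin (hn : 2 ≤ n) (hp : p ∈ perms n) :
    p.reverse ∈ maxBeforeMin n ↔ p ∉ maxBeforeMin n := by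
  have hrev : [n, 1] <+ p.reverse ↔ [1, n] <+ p := by
    rw [← List.reverse_sublist, List.reverse_reverse]
    rfl
  rw [mem_maxBeforeMin, mem_maxBeforeMin, hrev, pair_sublist_comm hn hp]
  simp only [mem_perms_of_perm (List.reverse_perm p) hp, hp, true_and]

theorem card_maxBeforeMin (hn : 2 ≤ n) : (maxBeforeMin n).card = n.factorial / 2 := by
  have hcompl : (maxBeforeMin n).card = (perms n \ maxBeforeMin n).card := by
    refine Finset.card_nbij' List.reverse List.reverse (fun p hp => ?_) (fun p hp => ?_)
      (fun p _ => p.reverse_reverse) (fun p _ => p.reverse_reverse)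
    · have hrev := mem_perms_of_perm (List.reverse_perm p) (maxBeforeMin_subset_perms n hp)
      refine Finset.mem_sdiff.2 ⟨hrev, ?_⟩
      rwa [← reverse_mem_maxBeforeMin hn hrev, List.reverse_reverse]
    · obtain ⟨hpn, hp⟩ := Finset.mem_sdiff.1 hp
      exact (reverse_mem_maxBeforeMin hn hpn).2 hp
  have hsum := Finset.card_sdiff_add_card_eq_card (maxBeforeMin_subset_perms n)
  rw [card_perms] at hsum
  omega

theorem pair_sublist_map_shift_iff (hv : v ∈ perms m) :
    [m + 1, 1] <+ v.map (shift i) ↔ 1 < i ∧ i ≤ m ∧ [m, 1] <+ v := by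
  rw [List.sublist_map_iff]
  constructor
  · rintro ⟨_ | ⟨y, _ | ⟨z, _ | ⟨_, _⟩⟩⟩, hsub, heq⟩ <;>
      simp only [List.map_nil, List.map_cons, List.cons.injEq, reduceCtorEq, and_false] at heq
    have hy := (mem_iff_of_mem_perms hv).1 (hsub.subset (by simp : y ∈ [y, z]))
    have hz := (mem_iff_of_mem_perms hv).1 (hsub.subset (by simp : z ∈ [y, z]))
    obtain ⟨hym, hz1, -⟩ := heq
    unfold shift at hym hz1
    obtain rfl : y = m := by split_ifs at hym <;> omega
    obtain rfl : z = 1 := by split_ifs at hz1 <;> omega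
    refine ⟨?_, ?_, hsub⟩
    · split_ifs at hz1 <;> omega
    · split_ifs at hym <;> omega
  · rintro ⟨h1, hm, hsub⟩
    refine ⟨[m, 1], hsub, ?_⟩
    simp only [List.map_cons, List.map_nil, shift, if_neg hm.not_gt, if_pos h1]

theorem append_mem_maxBeforeMin_iff (hm : 1 ≤ m) (hv : v ∈ perms m) (h1 : 1 ≤ i) (h2 : i ≤ m + 1) :
    append v i ∈ maxBeforeMin (m + 1) ↔ i = 1 ∨ i ≤ m ∧ v ∈ maxBeforeMin m := by
  have hmax : m + 1 ∈ v.map (shift 1) :=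
    List.mem_map.2 ⟨m, (mem_iff_of_mem_perms hv).2 ⟨hm, le_rfl⟩, if_neg hm.not_gt⟩
  rw [mem_maxBeforeMin, mem_maxBeforeMin, append, pair_sublist_concat_iff,
    pair_sublist_map_shift_iff hv, ← append]
  simp only [append_mem_perms hv h1 h2, hv, true_and]
  rcases h1.eq_or_lt with rfl | h1
  · simp only [hmax, true_and, true_or]
  · simp only [h1, h1.ne, h1.ne', false_and, false_or, true_and]

theorem cons_map_shift_mem_maxBeforeMin_iff (hm : 1 ≤ m) (hv : v ∈ perms m) (h1 : 1 ≤ x)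
    (h2 : x ≤ m + 1) :
    x :: v.map (shift x) ∈ maxBeforeMin (m + 1) ↔ x = m + 1 ∨ 1 < x ∧ v ∈ maxBeforeMin m := by
  have hone : 1 ∈ v.map (shift (m + 1)) :=
    List.mem_map.2 ⟨1, (mem_iff_of_mem_perms hv).2 ⟨le_rfl, hm⟩, if_pos (Nat.lt_succ_of_le hm)⟩
  have hperm := mem_perms_of_perm (cons_map_shift_perm_append x v) (append_mem_perms hv h1 h2)
  rw [mem_maxBeforeMin, mem_maxBeforeMin, pair_sublist_cons_iff, pair_sublist_map_shift_iff hv]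
  simp only [hperm, hv, true_and]
  rcases h2.eq_or_lt with rfl | h2
  · simp only [hone, true_and, true_or]
  · simp only [h2.ne, h2.ne', false_and, false_or, Nat.le_of_lt_succ h2, true_and]

theorem red_mem_maxBeforeMin {X z : ℕ} (hu : u.Nodup) (hXz : [X, z] <+ u) (hX : ∀ x ∈ u, x ≤ X)
    (hz : ∀ x ∈ u, z ≤ x) : red u ∈ maxBeforeMin u.length := by
  refine mem_maxBeforeMin.2 ⟨red_mem_perms hu, ?_⟩
  rw [← rank_eq_length hu hX, ← rank_eq_one (hXz.subset (by simp)) hz]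
  exact hXz.map (rank u)

end MaxBeforeMin

section PatternGraph

variable {m i x y N X : ℕ} {p q u v A B : List ℕ} {P : Finset (List ℕ)}

/-- The graph of overlapping patterns: the edge `p` leads from the pattern of all letters of `p` but
the last one to the pattern of all letters but the first one, and is labelled by its last letter
(`0` for the empty word). -/
def patternGraph : LabelledDigraph (List ℕ) (List ℕ) ℕ where
  src p := red p.dropLast
  tgt p := red p.tail
  lab p := p.getLastD 0

theorem src_append (hv : v ∈ perms m) (i : ℕ) : patternGraph.src (append v i) = v := by
  change red (v.map (shift i) ++ [i]).dropLast = v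
  rw [List.dropLast_concat, red_map_shift, red_eq_self hv]

theorem lab_append (v : List ℕ) (i : ℕ) : patternGraph.lab (append v i) = i :=
  List.getLastD_concat

theorem exists_eq_append (hp : p ∈ perms (m + 1)) :
    ∃ v ∈ perms m, ∃ i, 1 ≤ i ∧ i ≤ m + 1 ∧ p = append v i := by
  obtain rfl | ⟨l, i, rfl⟩ := p.eq_nil_or_concat'
  · simpa using length_of_mem_perms hp
  · have hi := (mem_iff_of_mem_perms hp).1 (by simp : i ∈ l ++ [i])
    obtain rfl : l.length = m := by simpa using length_of_mem_perms hp
    have hl := (nodup_of_mem_perms hp).sublist (List.sublist_append_left l [i])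
    exact ⟨red l, red_mem_perms hl, i, hi.1, hi.2, (append_red hp).symm⟩

theorem exists_eq_cons_map_shift (hp : p ∈ perms (m + 1)) :
    ∃ x, 1 ≤ x ∧ x ≤ m + 1 ∧ patternGraph.tgt p ∈ perms m ∧
      p = x :: (patternGraph.tgt p).map (shift x) := by
  cases p with
  | nil => simpa using length_of_mem_perms hp
  | cons x l =>
    have hx := (mem_iff_of_mem_perms hp).1 (List.mem_cons_self (a := x) (l := l))
    obtain rfl : l.length = m := by simpa using length_of_mem_perms hp
    exact ⟨x, hx.1, hx.2, red_mem_perms (nodup_of_mem_perms hp).of_cons,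
      congrArg (x :: ·) (map_shift_red hp).symm⟩

theorem src_mem_perms (hp : p ∈ perms (m + 1)) : patternGraph.src p ∈ perms m := by
  obtain ⟨v, hv, i, -, -, rfl⟩ := exists_eq_append hp
  rwa [src_append hv]

theorem card_in_le_card_out_perms (n : ℕ) (u : List ℕ) :
    ((perms n).filter (patternGraph.tgt · = u)).card ≤
      ((perms n).filter (patternGraph.src · = u)).card := by
  refine Finset.card_le_card_of_injOn (List.rotate · 1) (fun p hp => ?_)
    (List.rotate_injective 1).injOn
  obtain ⟨hpn, rfl⟩ := Finset.mem_filter.1 hp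
  refine Finset.mem_filter.2 ⟨mem_perms_of_perm (List.rotate_perm p 1) hpn, ?_⟩
  cases p with
  | nil => rfl
  | cons x l =>
    change red ((x :: l).rotate 1).dropLast = red l
    rw [List.rotate_cons_succ, List.rotate_zero, List.dropLast_concat]

/-- An edge `x :: _` into `u` is turned into the edge out of `u` with label `x`, or with label `1`
if `x` is the largest letter; no edge in `maxBeforeMin` starts with `1`, so this is injective. -/
theorem card_in_le_card_out_maxBeforeMin (hm : 1 ≤ m) (u : List ℕ) :
    ((maxBeforeMin (m + 1)).filter (patternGraph.tgt · = u)).card ≤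
      ((maxBeforeMin (m + 1)).filter (patternGraph.src · = u)).card := by
  have hin : ∀ p ∈ (maxBeforeMin (m + 1)).filter (patternGraph.tgt · = u),
      ∃ x, 1 < x ∧ x ≤ m + 1 ∧ p = x :: u.map (shift x) ∧ u ∈ perms m ∧
        (x = m + 1 ∨ u ∈ maxBeforeMin m) := by
    intro p hp
    obtain ⟨hpm, rfl⟩ := Finset.mem_filter.1 hp
    obtain ⟨x, hx1, hxm, htgt, heq⟩ := exists_eq_cons_map_shift (maxBeforeMin_subset_perms _ hpm)
    rw [heq, cons_map_shift_mem_maxBeforeMin_iff hm htgt hx1 hxm] at hpm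
    exact ⟨x, hpm.elim (by omega) And.left, hxm, heq, htgt, hpm.imp_right And.right⟩
  refine Finset.card_le_card_of_injOn
    (fun p => append u (if p.headD 0 = m + 1 then 1 else p.headD 0)) ?_ ?_
  · intro p hp
    obtain ⟨x, hx1, hxm, rfl, hu, hx⟩ := hin p hp
    refine Finset.mem_filter.2 ⟨?_, src_append hu _⟩
    change append u (if x = m + 1 then 1 else x) ∈ maxBeforeMin (m + 1)
    split_ifs with hmax
    · exact (append_mem_maxBeforeMin_iff hm hu le_rfl (by omega)).2 (Or.inl rfl)
    · exact (append_mem_maxBeforeMin_iff hm hu hx1.le hxm).2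
        (Or.inr ⟨by omega, hx.resolve_left hmax⟩)
  · intro p hp q hq hpq
    obtain ⟨x, hx1, -, rfl, -⟩ := hin p hp
    obtain ⟨y, hy1, -, rfl, -⟩ := hin q hq
    have hlab : (if x = m + 1 then 1 else x) = if y = m + 1 then 1 else y :=
      (lab_append u _).symm.trans ((congrArg patternGraph.lab hpq).trans (lab_append u _))
    obtain rfl : x = y := by split_ifs at hlab <;> omega
    rfl

theorem topEdge_append (hP : P ⊆ perms (m + 1)) (hv : v ∈ perms m) (hmem : append v i ∈ P)
    (hmax : ∀ j, append v j ∈ P → j ≤ i) :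
    patternGraph.TopEdge P v (patternGraph.tgt (append v i)) := by
  refine ⟨append v i, hmem, src_append hv i, rfl, fun p hp hsrc hne => ?_⟩
  obtain ⟨v, hv', j, -, -, rfl⟩ := exists_eq_append (hP hp)
  obtain rfl := (src_append hv' j).symm.trans hsrc
  rw [lab_append, lab_append]
  exact (hmax j hp).lt_of_ne fun h => hne (h ▸ rfl)

theorem topEdge_red (hP : P ⊆ perms (m + 1)) (hnodup : (x :: u ++ [y]).Nodup)
    (hu : (x :: u).length = m) (hmem : red (x :: u ++ [y]) ∈ P)
    (hmax : ∀ j, append (red (x :: u)) j ∈ P → j ≤ rank (x :: u ++ [y]) y) :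
    patternGraph.TopEdge P (red (x :: u)) (red (u ++ [y])) := by
  have htgt : red (u ++ [y]) = patternGraph.tgt (red (x :: u ++ [y])) :=
    (red_tail_red (x :: u ++ [y])).symm
  rw [htgt, red_concat hnodup]
  rw [red_concat hnodup] at hmem
  exact topEdge_append hP (hu ▸ red_mem_perms hnodup.of_append_left) hmem hmax

theorem nodup_concat (hu : u.Nodup) (hy : y ∉ u) : (u ++ [y]).Nodup :=
  List.nodup_append'.2 ⟨hu, List.nodup_singleton y, List.disjoint_singleton.2 hy⟩

theorem topEdge_perms_of_forall_lt (hnodup : (x :: u).Nodup) (hlen : (x :: u).length = m)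
    (hlt : ∀ a ∈ x :: u, a < N) :
    patternGraph.TopEdge (perms (m + 1)) (red (x :: u)) (red (u ++ [N])) := by
  have hnodup' := nodup_concat hnodup fun h => (hlt N h).false
  have hlen' : (x :: u ++ [N]).length = m + 1 := by simpa using hlen
  have hle : ∀ a ∈ x :: u ++ [N], a ≤ N :=
    List.forall_mem_append.2 ⟨fun a ha => (hlt a ha).le, List.forall_mem_singleton.2 le_rfl⟩
  refine topEdge_red Finset.Subset.rfl hnodup' hlen (hlen' ▸ red_mem_perms hnodup') fun j hj => ?_
  rw [rank_eq_length hnodup' hle, hlen']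
  exact ((mem_iff_of_mem_perms hj).1 (by simp [append])).2

theorem reach_perms_of_forall_lt (hnodup : (A ++ B).Nodup) (hlen : (A ++ B).length = m)
    (hlt : ∀ a ∈ A ++ B, a < N) :
    Relation.ReflTransGen (patternGraph.TopEdge (perms (m + 1))) (red (A ++ B))
      (red (B ++ List.range' N A.length)) := by
  induction A generalizing B N with
  | nil => simpa using Relation.ReflTransGen.refl
  | cons x A ih =>
    have hrest := ih (B := B ++ [N]) (N := N + 1) ?_ ?_ ?_
    · rw [List.append_assoc, List.singleton_append, ← List.range'_succ] at hrest
      refine .head ?_ hrest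
      rw [← List.append_assoc]
      exact topEdge_perms_of_forall_lt hnodup hlen hlt
    all_goals rw [← List.append_assoc]
    · exact nodup_concat hnodup.of_cons fun h => (hlt N (List.mem_cons_of_mem x h)).false
    · simpa [add_assoc, add_comm] using hlen
    · refine List.forall_mem_append.2 ⟨fun a ha => ?_, List.forall_mem_singleton.2 N.lt_succ_self⟩
      exact (hlt a (List.mem_cons_of_mem x ha)).trans N.lt_succ_self

theorem isGreedyEulerian_perms (m : ℕ) :
    patternGraph.IsGreedyEulerian (perms (m + 1)) (List.range' 1 m) where
  card_in_le_card_out := card_in_le_card_out_perms (m + 1)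
  reach p hp := by
    have hv := src_mem_perms hp
    have hreach := reach_perms_of_forall_lt (A := patternGraph.src p) (B := []) (N := m + 1)
      (by simpa using nodup_of_mem_perms hv) (by simpa using length_of_mem_perms hv)
      (by simp [mem_iff_of_mem_perms hv])
    rwa [List.append_nil, List.nil_append, red_eq_self hv, length_of_mem_perms hv,
      red_eq_range' List.pairwise_lt_range', List.length_range'] at hreach

theorem topEdge_maxBeforeMin_of_forall_lt {z : ℕ} (hnodup : (x :: u).Nodup)
    (hlen : (x :: u).length = m) (hXz : [X, z] <+ x :: u) (hlt : ∀ a ∈ x :: u, a ≠ X → a < N)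
    (hNX : N < X) (hz : ∀ a ∈ x :: u, z ≤ a) :
    patternGraph.TopEdge (maxBeforeMin (m + 1)) (red (x :: u)) (red (u ++ [N])) := by
  have hX_mem : X ∈ x :: u := hXz.subset (by simp)
  have hz_mem : z ∈ x :: u := hXz.subset (by simp)
  have hzX : z ≠ X := fun h => by simpa [h] using hnodup.sublist hXz
  have hnodup' := nodup_concat hnodup fun h => (hlt N h hNX.ne).false
  have hlen' : (x :: u ++ [N]).length = m + 1 := by simpa using hlen
  have hleX : ∀ a ∈ x :: u ++ [N], a ≤ X := List.forall_mem_append.2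
    ⟨fun a ha => (eq_or_ne a X).elim le_of_eq fun h => ((hlt a ha h).trans hNX).le,
      List.forall_mem_singleton.2 hNX.le⟩
  have hzle : ∀ a ∈ x :: u ++ [N], z ≤ a := List.forall_mem_append.2
    ⟨hz, List.forall_mem_singleton.2 (hlt z hz_mem hzX).le⟩
  have hleN : ∀ a ∈ x :: u ++ [N], a ≠ X → a ≤ N := List.forall_mem_append.2
    ⟨fun a ha h => (hlt a ha h).le, List.forall_mem_singleton.2 fun _ => le_rfl⟩
  refine topEdge_red (maxBeforeMin_subset_perms _) hnodup' hlen ?_ fun j hj => ?_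
  · exact hlen' ▸ red_mem_maxBeforeMin hnodup' (hXz.trans (List.sublist_append_left _ _)) hleX hzle
  · rw [rank_eq_length_sub_one hnodup' (List.mem_append_left _ hX_mem) hNX hleN, hlen',
      Nat.add_sub_cancel]
    have hm : 1 ≤ m := hlen ▸ Nat.le_add_left 1 u.length
    have hj_mem := maxBeforeMin_subset_perms _ hj
    have hj_bounds := (mem_iff_of_mem_perms hj_mem).1 (by simp [append] : j ∈ append _ j)
    rw [append_mem_maxBeforeMin_iff hm (hlen ▸ red_mem_perms hnodup) hj_bounds.1 hj_bounds.2] at hj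
    exact hj.elim (fun h => h ▸ hm) And.left

theorem reach_maxBeforeMin_of_forall_lt {z : ℕ} (hnodup : (A ++ B).Nodup)
    (hlen : (A ++ B).length = m) (hXz : [X, z] <+ B) (hlt : ∀ a ∈ A ++ B, a ≠ X → a < N)
    (hNX : N + A.length ≤ X) (hz : ∀ a ∈ A ++ B, z ≤ a) :
    Relation.ReflTransGen (patternGraph.TopEdge (maxBeforeMin (m + 1))) (red (A ++ B))
      (red (B ++ List.range' N A.length)) := by
  induction A generalizing B N with
  | nil => simpa using Relation.ReflTransGen.refl
  | cons x A ih =>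
    rw [List.length_cons] at hNX
    have hNX' : N < X := by omega
    have hrest := ih (B := B ++ [N]) (N := N + 1) ?_ ?_
      (hXz.trans (List.sublist_append_left _ _)) ?_ (by omega) ?_
    · rw [List.append_assoc, List.singleton_append, ← List.range'_succ] at hrest
      refine .head ?_ hrest
      rw [← List.append_assoc]
      exact topEdge_maxBeforeMin_of_forall_lt hnodup hlen
        (hXz.trans (List.sublist_append_right (x :: A) B)) hlt hNX' hz
    all_goals rw [← List.append_assoc]
    · exact nodup_concat hnodup.of_cons fun h => (hlt N (List.mem_cons_of_mem x h) hNX'.ne).false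
    · simpa [add_assoc, add_comm] using hlen
    · refine List.forall_mem_append.2 ⟨fun a ha haX => ?_,
        List.forall_mem_singleton.2 fun _ => N.lt_succ_self⟩
      exact (hlt a (List.mem_cons_of_mem x ha) haX).trans N.lt_succ_self
    · refine List.forall_mem_append.2 ⟨fun a ha => hz a (List.mem_cons_of_mem x ha),
        List.forall_mem_singleton.2 ?_⟩
      have hzX : z ≠ X := fun h => by
        simpa [h] using hnodup.sublist (hXz.trans (List.sublist_append_right (x :: A) B))
      exact (hlt z (List.mem_append_right _ (hXz.subset (by simp))) hzX).le

theorem red_replace_max (h : A ++ m :: B ∈ perms m) (hX : m ≤ X) :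
    red (A ++ X :: B) = A ++ m :: B := by
  have hnodup := (List.nodup_middle.1 (nodup_of_mem_perms h))
  have hAB : m ∉ A ++ B := (List.nodup_cons.1 hnodup).1
  rw [List.mem_append, not_or] at hAB
  have hid (l : List ℕ) (hl : m ∉ l) : l.map (fun a => if a = m then X else a) = l :=
    (List.map_congr_left fun a ha => if_neg fun e : a = m => hl (e ▸ ha)).trans (List.map_id l)
  have hmap : (A ++ m :: B).map (fun a => if a = m then X else a) = A ++ X :: B := by
    rw [List.map_append, List.map_cons, hid A hAB.1, hid B hAB.2, if_pos rfl]
  rw [← hmap, red_map, red_eq_self h]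
  intro a _ b hb hab
  have hbm := ((mem_iff_of_mem_perms h).1 hb).2
  dsimp only
  split_ifs <;> omega

theorem nodup_append_range' (hB : B.Nodup) (hlt : ∀ a ∈ B, a < N) (k : ℕ) :
    (B ++ List.range' N k).Nodup := by
  refine List.nodup_append'.2 ⟨hB, List.nodup_range', fun a ha ha' => ?_⟩
  exact (hlt a ha).not_ge (List.mem_range'_1.1 ha').1

theorem reach_maxBeforeMin_of_max (h : A ++ m :: B ∈ perms m) (hB : 1 ∈ B) :
    Relation.ReflTransGen (patternGraph.TopEdge (maxBeforeMin (m + 1))) (A ++ m :: B)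
      (red (B ++ List.range' m (A.length + 1))) := by
  -- Enlarging the largest letter to `X` makes room for the `A.length` letters appended before it
  -- is dropped.
  obtain ⟨X, hX⟩ : ∃ X, X = m + A.length + 1 := ⟨_, rfl⟩
  obtain ⟨hmAB, hAB⟩ := List.nodup_cons.1 (List.nodup_middle.1 (nodup_of_mem_perms h))
  have hle : ∀ a ∈ A ++ B, 1 ≤ a ∧ a < m := fun a ha => by
    have hbounds := (mem_iff_of_mem_perms h).1
      (List.perm_middle.mem_iff.2 (List.mem_cons_of_mem m ha))
    exact ⟨hbounds.1, hbounds.2.lt_of_ne fun e => hmAB (e ▸ ha)⟩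
  have hleB : ∀ a ∈ B, 1 ≤ a ∧ a < m := fun a ha => hle a (List.mem_append_right A ha)
  have hm : 1 < m := (hleB 1 hB).2
  have hlen : (A ++ X :: B).length = m := by simpa using length_of_mem_perms h
  have hmiddle (a : ℕ) (ha : a ∈ A ++ X :: B) : a = X ∨ a ∈ A ++ B :=
    List.mem_cons.1 (List.perm_middle.mem_iff.1 ha)
  have hmem : ∀ a ∈ B ++ List.range' m A.length, 1 ≤ a ∧ a < m + A.length :=
    List.forall_mem_append.2 ⟨fun a ha => ⟨(hleB a ha).1, (hleB a ha).2.trans_le (by omega)⟩,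
      fun a ha => by rw [List.mem_range'_1] at ha; omega⟩
  have hreach : Relation.ReflTransGen (patternGraph.TopEdge (maxBeforeMin (m + 1)))
      (red (A ++ X :: B)) (red (X :: B ++ List.range' m A.length)) := by
    refine reach_maxBeforeMin_of_forall_lt (X := X) (N := m) (z := 1) ?_ hlen
      (List.cons_sublist_cons.2 (List.singleton_sublist.2 hB))
      (fun a ha haX => (hle a ((hmiddle a ha).resolve_left haX)).2) (by omega)
      (fun a ha => (hmiddle a ha).elim (fun e => by omega) fun ha => (hle a ha).1)
    exact List.nodup_middle.2 (List.nodup_cons.2 ⟨fun hmem => by have := hle X hmem; omega, hAB⟩)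
  rw [red_replace_max h (by omega)] at hreach
  refine hreach.tail ?_
  rw [List.range'_1_concat, ← List.append_assoc]
  refine topEdge_maxBeforeMin_of_forall_lt (X := X) (z := 1) ?_ ?_
    (List.cons_sublist_cons.2 (List.singleton_sublist.2 (List.mem_append_left _ hB)))
    (List.forall_mem_cons.2 ⟨fun h => absurd rfl h, fun a ha _ => (hmem a ha).2⟩) (by omega)
    (List.forall_mem_cons.2 ⟨by omega, fun a ha => (hmem a ha).1⟩)
  · exact List.nodup_cons.2 ⟨fun hX_mem => by have := hmem X hX_mem; omega,
      nodup_append_range' hAB.of_append_right (fun a ha => (hleB a ha).2) _⟩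
  · simpa [add_assoc, add_comm, add_left_comm] using hlen

theorem reach_maxBeforeMin_of_last_two (h : A ++ [m, 1] ∈ perms m) :
    Relation.ReflTransGen (patternGraph.TopEdge (maxBeforeMin (m + 1))) (A ++ [m, 1])
      (List.range' 1 m) := by
  have hlen : A.length + 2 = m := by simpa using length_of_mem_perms h
  have hreach := reach_maxBeforeMin_of_max h (List.mem_singleton_self 1)
  rwa [red_eq_range', List.length_append, List.length_range', List.length_singleton,
    show 1 + (A.length + 1) = m by omega] at hreach
  refine List.pairwise_cons.2 ⟨fun a ha => ?_, List.pairwise_lt_range'⟩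
  have := List.mem_range'_1.1 ha
  omega

theorem topEdge_maxBeforeMin_of_notMem (hm : 1 ≤ m) (hu : u ∈ perms m)
    (hmax : u ∉ maxBeforeMin m) :
    patternGraph.TopEdge (maxBeforeMin (m + 1)) u (patternGraph.tgt (append u 1)) := by
  refine topEdge_append (maxBeforeMin_subset_perms _) hu
    ((append_mem_maxBeforeMin_iff hm hu le_rfl (by omega)).2 (Or.inl rfl)) fun j hj => ?_
  have hbounds := (mem_iff_of_mem_perms (maxBeforeMin_subset_perms _ hj)).1
    (by simp [append] : j ∈ append u j)
  rw [append_mem_maxBeforeMin_iff hm hu hbounds.1 hbounds.2] at hj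
  exact (hj.resolve_right fun h => hmax h.2).le

theorem tgt_append_one_mem_maxBeforeMin (hm : 2 ≤ m) (hu : u ∈ perms m)
    (hmax : u ∉ maxBeforeMin m) : patternGraph.tgt (append u 1) ∈ maxBeforeMin m := by
  have hp : append u 1 ∈ maxBeforeMin (m + 1) :=
    (append_mem_maxBeforeMin_iff (by omega) hu le_rfl (by omega)).2 (Or.inl rfl)
  obtain ⟨x, hx1, hxm, htgt, heq⟩ := exists_eq_cons_map_shift (maxBeforeMin_subset_perms _ hp)
  rw [heq, cons_map_shift_mem_maxBeforeMin_iff (by omega) htgt hx1 hxm] at hp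
  refine (hp.resolve_left ?_).2
  rintro rfl
  cases u with
  | nil => exact absurd (length_of_mem_perms hu) (Nat.ne_of_lt (Nat.zero_lt_of_lt hm))
  | cons y l =>
    have hy : shift 1 y = m + 1 := (List.cons.inj heq).1
    have hy1 := ((mem_iff_of_mem_perms hu).1 List.mem_cons_self).1
    obtain rfl : y = m := by rw [shift, if_neg (by omega)] at hy; omega
    have h1 : 1 ∈ l := (List.mem_cons.1 ((mem_iff_of_mem_perms hu).2 ⟨le_rfl, hy1⟩)).resolve_left
      (by omega)
    exact hmax (mem_maxBeforeMin.2
      ⟨hu, List.cons_sublist_cons.2 (List.singleton_sublist.2 h1)⟩)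

theorem reach_maxBeforeMin_of_last (hm : 2 ≤ m) (h : A ++ [m] ∈ perms m) :
    Relation.ReflTransGen (patternGraph.TopEdge (maxBeforeMin (m + 1))) (A ++ [m])
      (List.range' 1 m) := by
  have hnotMem : A ++ [m] ∉ maxBeforeMin m := fun hmem => by
    obtain h1 | h1 := pair_sublist_concat_iff.1 (mem_maxBeforeMin.1 hmem).2
    · omega
    · exact List.disjoint_singleton.1
        (List.nodup_append'.1 (nodup_of_mem_perms h)).2.2 (h1.subset (by simp))
  have hmem := maxBeforeMin_subset_perms _ (tgt_append_one_mem_maxBeforeMin hm h hnotMem)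
  have hedge := topEdge_maxBeforeMin_of_notMem (by omega) h hnotMem
  have hnodup := nodup_append (nodup_of_mem_perms h) 1
  cases A with
  | nil => exact absurd (length_of_mem_perms h) (Nat.ne_of_lt hm)
  | cons x A =>
    obtain ⟨U, hU⟩ : ∃ U, U = A.map (shift 1) ++ [m + 1, 1] := ⟨_, rfl⟩
    have htail : (append (x :: A ++ [m]) 1).tail = U := by
      simp [hU, append, shift, show ¬ m = 0 by omega]
    have htgt : patternGraph.tgt (append (x :: A ++ [m]) 1) = red U := congrArg red htail
    have hU_le : ∀ a ∈ U, 1 ≤ a ∧ a ≤ m + 1 := fun a ha =>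
      (mem_iff_of_mem_perms (append_mem_perms h le_rfl (by omega))).1
        (List.mem_of_mem_tail (htail ▸ ha))
    have hU_nodup : U.Nodup := htail ▸ hnodup.tail
    have hU_len : U.length = m := by
      rw [← length_red, ← htgt, length_of_mem_perms hmem]
    have hred : red U = A.map (fun a => rank U (shift 1 a)) ++ [m, 1] := by
      rw [red_eq_map]
      nth_rewrite 2 [hU]
      rw [List.map_append, List.map_map, List.map_cons, List.map_singleton,
        rank_eq_length hU_nodup fun a ha => (hU_le a ha).2, hU_len,
        rank_eq_one (by simp [hU]) fun a ha => (hU_le a ha).1]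
      rfl
    rw [htgt, hred] at hmem hedge
    exact .head hedge (reach_maxBeforeMin_of_last_two hmem)

theorem exists_red_concat_eq (hnodup : (A ++ [N]).Nodup) (hlt : ∀ a ∈ A, a < N) :
    ∃ D, red (A ++ [N]) = D ++ [A.length + 1] := by
  have hle : ∀ a ∈ A ++ [N], a ≤ N :=
    List.forall_mem_append.2 ⟨fun a ha => (hlt a ha).le, List.forall_mem_singleton.2 le_rfl⟩
  rw [red_concat hnodup, rank_eq_length hnodup hle, List.length_append, List.length_singleton]
  exact ⟨_, rfl⟩

theorem reach_maxBeforeMin_of_mem (hu : u ∈ maxBeforeMin m) :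
    Relation.ReflTransGen (patternGraph.TopEdge (maxBeforeMin (m + 1))) u (List.range' 1 m) := by
  obtain ⟨hperm, hsub⟩ := mem_maxBeforeMin.1 hu
  obtain ⟨A, B, rfl, hB⟩ : ∃ A B, u = A ++ m :: B ∧ 1 ∈ B := by
    obtain ⟨R, S, rfl, hR, hS⟩ := List.cons_sublist_iff.1 hsub
    obtain ⟨A, B, rfl⟩ := List.append_of_mem hR
    exact ⟨A, B ++ S, by simp, List.mem_append_right B (List.singleton_sublist.1 hS)⟩
  have hB_lt : ∀ a ∈ B, a < m := fun a ha =>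
    ((mem_iff_of_mem_perms hperm).1 (by simp [ha])).2.lt_of_ne fun e =>
      (List.nodup_cons.1 (nodup_of_mem_perms hperm).of_append_right).1 (e ▸ ha)
  have hlen : A.length + (B.length + 1) = m := by simpa using length_of_mem_perms hperm
  have hnodup := nodup_append_range' (nodup_of_mem_perms hperm).of_append_right.of_cons hB_lt
    (A.length + 1)
  have hmem := red_mem_perms hnodup
  have hreach := reach_maxBeforeMin_of_max hperm hB
  rw [List.length_append, List.length_range', show B.length + (A.length + 1) = m by omega] at hmem
  rw [List.range'_1_concat, ← List.append_assoc] at hnodup hmem hreach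
  obtain ⟨D, hD⟩ := exists_red_concat_eq hnodup (List.forall_mem_append.2
    ⟨fun a ha => (hB_lt a ha).trans_le (Nat.le_add_right _ _),
      fun a ha => (List.mem_range'_1.1 ha).2⟩)
  rw [hD, List.length_append, List.length_range',
    show B.length + A.length + 1 = m by omega] at hmem hreach
  have hm : 2 ≤ m := by
    have := List.length_pos_of_mem hB
    omega
  exact hreach.trans (reach_maxBeforeMin_of_last hm hmem)

theorem isGreedyEulerian_maxBeforeMin (hm : 1 ≤ m) :
    patternGraph.IsGreedyEulerian (maxBeforeMin (m + 1)) (List.range' 1 m) where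
  card_in_le_card_out := card_in_le_card_out_maxBeforeMin hm
  reach p hp := by
    have hu := src_mem_perms (maxBeforeMin_subset_perms _ hp)
    by_cases hmax : patternGraph.src p ∈ maxBeforeMin m
    · exact reach_maxBeforeMin_of_mem hmax
    obtain rfl | hm2 := hm.eq_or_lt
    · rw [mem_perms, List.range'_one, List.perm_singleton] at hu
      rw [hu, List.range'_one]
    · exact .head (topEdge_maxBeforeMin_of_notMem hm hu hmax)
        (reach_maxBeforeMin_of_mem (tgt_append_one_mem_maxBeforeMin hm2 hu hmax))

theorem lab_lt_of_mem_maxBeforeMin (hm : 1 ≤ m) (hq : q ∈ maxBeforeMin (m + 1))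
    (hp : p ∈ perms (m + 1)) (hp' : p ∉ maxBeforeMin (m + 1))
    (hsrc : patternGraph.src q = patternGraph.src p) :
    patternGraph.lab q < patternGraph.lab p := by
  obtain ⟨v, hv, i, hi1, him, rfl⟩ := exists_eq_append (maxBeforeMin_subset_perms _ hq)
  obtain ⟨v', hv', j, hj1, hjm, rfl⟩ := exists_eq_append hp
  obtain rfl : v = v' := by rwa [src_append hv, src_append hv'] at hsrc
  rw [append_mem_maxBeforeMin_iff hm hv hi1 him] at hq
  rw [append_mem_maxBeforeMin_iff hm hv hj1 hjm] at hp'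
  rw [lab_append, lab_append]
  by_cases hvm : v ∈ maxBeforeMin m <;> simp only [hvm, and_true, and_false, or_false] at hq hp'
  all_goals omega

end PatternGraph

section Pattern

variable {m n k j i : ℕ} {w : List ℕ}

/-- The pattern of the factor of length `n` of `w` that starts after `k` letters; in the paper's
notation, `sigma n w (k + 1)`. -/
def pattern (n : ℕ) (w : List ℕ) (k : ℕ) : List ℕ := red ((w.drop k).take n)

theorem pattern_mem_perms (hw : w.Nodup) (h : k + n ≤ w.length) : pattern n w k ∈ perms n := by
  have hlen : ((w.drop k).take n).length = n := by
    rw [List.length_take, List.length_drop]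
    omega
  have hnodup := hw.sublist ((List.take_sublist n _).trans (List.drop_sublist k w))
  have hmem := red_mem_perms hnodup
  rwa [hlen] at hmem

theorem src_pattern (h : k + m < w.length) :
    patternGraph.src (pattern (m + 1) w k) = pattern m w k := by
  change red (red ((w.drop k).take (m + 1))).dropLast = red ((w.drop k).take m)
  have hlen : ((w.drop k).take (m + 1)).length = m + 1 := by
    rw [List.length_take, List.length_drop]
    omega
  rw [red_dropLast_red, List.dropLast_eq_take, hlen, List.take_take, Nat.add_sub_cancel,
    min_eq_left m.le_succ]

theorem tgt_pattern (m : ℕ) (w : List ℕ) (k : ℕ) :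
    patternGraph.tgt (pattern (m + 1) w k) = pattern m w (k + 1) := by
  change red (red ((w.drop k).take (m + 1))).tail = red ((w.drop (k + 1)).take m)
  rw [red_tail_red, ← List.drop_one, List.drop_take, List.drop_drop, Nat.add_sub_cancel]

theorem pattern_append (b : ℕ) (h : k + n ≤ w.length) :
    pattern n (append w b) k = pattern n w k := by
  rw [pattern, append, List.drop_append_of_le_length (by rw [List.length_map]; omega),
    List.take_append_of_le_length (by rw [List.length_drop, List.length_map]; omega),
    ← List.map_drop, ← List.map_take, red_map_shift, pattern]

theorem red_extension_rtake (hw : w.Nodup) (hm : m ≤ w.length) (h1 : 1 ≤ i) (h2 : i ≤ m + 1) :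
    red (extension (w.rtake m) i) = append (pattern m w (w.length - m)) i := by
  have hlen : (w.rtake m).length = m := by
    rw [List.rtake, List.length_drop]
    omega
  have hv : (w.rtake m).Nodup := hw.sublist (List.drop_sublist _ _)
  rw [red_extension hv h1 (hlen.symm ▸ h2), pattern, ← List.rtake, List.take_of_length_le hlen.le]

theorem pattern_append_extLetter (hw : w.Nodup) (hm : m ≤ w.length) (h1 : 1 ≤ i)
    (h2 : i ≤ m + 1) :
    pattern (m + 1) (append w (extLetter (w.rtake m) i)) (w.length - m) =
      append (pattern m w (w.length - m)) i := by
  rw [← red_extension_rtake hw hm h1 h2, pattern, append,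
    List.drop_append_of_le_length (by simp), ← List.map_drop,
    List.take_of_length_le (by simp; omega)]
  rfl

theorem covers_iff {p : List ℕ} :
    Covers n w p ↔ ∃ k, k + n ≤ w.length ∧ pattern n w k = red p := by
  constructor
  · rintro ⟨u, ⟨a, c, rfl⟩, hu, hp⟩
    refine ⟨a.length, by simp only [List.length_append]; omega, ?_⟩
    rw [pattern, List.append_assoc, List.drop_left, List.take_left' hu, hp]
  · rintro ⟨k, hk, hp⟩
    refine ⟨(w.drop k).take n, ?_, ?_, hp⟩
    · exact (List.take_prefix _ _).isInfix.trans (List.drop_suffix _ _).isInfix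
    · rw [List.length_take, List.length_drop]
      omega

theorem covers_extension_iff (hw : w.Nodup) (hm : m ≤ w.length) (h1 : 1 ≤ i) (h2 : i ≤ m + 1) :
    Covers (m + 1) w (extension (w.rtake m) i) ↔
      ∃ k < w.length - m, pattern (m + 1) w k = append (pattern m w (w.length - m)) i := by
  rw [covers_iff, red_extension_rtake hw hm h1 h2]
  exact exists_congr fun k => and_congr_left' (by omega)

theorem getElem?_pattern_eq_one (hw : w ∈ perms w.length) (hj : j < n) (h : w[k + j]? = some 1) :
    (pattern n w k)[j]? = some 1 := by
  have hget : ((w.drop k).take n)[j]? = some 1 := by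
    rw [List.getElem?_take_of_lt hj, List.getElem?_drop, h]
  rw [pattern, red_eq_map, List.getElem?_map, hget, Option.map_some, Option.some_inj]
  refine rank_eq_one (List.mem_of_getElem? hget) fun x hx => ?_
  exact ((mem_iff_of_mem_perms hw).1 (List.mem_of_mem_drop (List.mem_of_mem_take hx))).1

end Pattern

section GreedyWord

variable {m n : ℕ} {w w' : List ℕ}

/-- The properties of the words produced by the greedy algorithm with `n = m + 1` that are preserved
by its steps: the patterns of length `m + 1` form a greedy walk starting at `1 2 ⋯ m`. -/
structure IsGreedyWord (m : ℕ) (w : List ℕ) : Prop where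
  mem_perms : w ∈ perms w.length
  le_length : m ≤ w.length
  pattern_zero : pattern m w 0 = List.range' 1 m
  isGreedyWalk :
    patternGraph.IsGreedyWalk (perms (m + 1)) (pattern (m + 1) w) (pattern m w) (w.length - m)

theorem isGreedyWord_range' (m : ℕ) : IsGreedyWord m (List.range' 1 m) where
  mem_perms := by simpa using range'_mem_perms m
  le_length := by simp
  pattern_zero := by
    rw [pattern, List.drop_zero, List.take_of_length_le (by simp), red_eq_self (range'_mem_perms m)]
  isGreedyWalk := by
    rw [List.length_range', Nat.sub_self]
    constructor <;> simp

theorem IsGreedyWord.append_extLetter_mem_perms {i : ℕ} (h : IsGreedyWord m w) (h1 : 1 ≤ i) :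
    append w (extLetter (w.rtake m) i) ∈ perms (w.length + 1) := by
  have hbounds (x : ℕ) (hx : x ∈ w.rtake m) : 1 ≤ x ∧ x ≤ w.length :=
    (mem_iff_of_mem_perms h.mem_perms).1 (List.mem_of_mem_drop hx)
  exact append_mem_perms h.mem_perms (one_le_extLetter (fun x hx => (hbounds x hx).1) h1)
    (extLetter_le (fun x hx => (hbounds x hx).2) i)

theorem IsGreedyWord.step (h : IsGreedyWord m w) (hs : Step (m + 1) w w') :
    IsGreedyWord m w' := by
  obtain ⟨i, ⟨⟨h1, h2, hnew⟩, hmin⟩, rfl⟩ := hs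
  rw [Nat.add_sub_cancel] at hnew hmin ⊢
  have hnodup := nodup_of_mem_perms h.mem_perms
  have hlen := h.le_length
  have hcov (j : ℕ) := covers_extension_iff (i := j) hnodup hlen
  obtain ⟨b, hb⟩ : ∃ b, b = extLetter (w.rtake m) i := ⟨_, rfl⟩
  have hlast : pattern (m + 1) (append w b) (w.length - m) =
      append (pattern m w (w.length - m)) i :=
    hb ▸ pattern_append_extLetter hnodup hlen h1 h2
  have hmem : append w b ∈ perms (append w b).length :=
    length_append w b ▸ hb ▸ h.append_extLetter_mem_perms h1
  have hold (k : ℕ) (hk : k < w.length - m) :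
      pattern (m + 1) (append w b) k = pattern (m + 1) w k := pattern_append b (by omega)
  have hold' (k : ℕ) (hk : k ≤ w.length - m) : pattern m (append w b) k = pattern m w k :=
    pattern_append b (by omega)
  have hwalk := h.isGreedyWalk.congr hold hold'
  rw [← hb]
  refine ⟨hmem, by rw [length_append]; omega, by rw [hold' 0 (Nat.zero_le _), h.pattern_zero], ?_⟩
  rw [length_append, show w.length + 1 - m = w.length - m + 1 by omega]
  refine hwalk.succ (pattern_mem_perms (nodup_of_mem_perms hmem) (by rw [length_append]; omega))
    (src_pattern (by rw [length_append]; omega)) (tgt_pattern m _ _) ?_ ?_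
  · intro k hk heq
    rw [hold k hk, hlast] at heq
    exact hnew ((hcov i h1 h2).2 ⟨k, hk, heq⟩)
  · intro q hq hsrc hlab
    obtain ⟨v, hv, j, hj1, hj2, rfl⟩ := exists_eq_append hq
    rw [src_append hv, hold' _ le_rfl] at hsrc
    rw [hlast, lab_append, lab_append] at hlab
    by_contra! hunused
    refine (hmin ⟨hj1, hj2, fun hc => ?_⟩).not_gt hlab
    obtain ⟨k, hk, heq⟩ := (hcov j hj1 hj2).1 hc
    exact hunused k hk (by rw [hold k hk, heq, hsrc])

theorem isGreedyWord_of_reflTransGen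
    (h : Relation.ReflTransGen (Step (m + 1)) (List.range' 1 m) w) : IsGreedyWord m w := by
  induction h with
  | refl => exact isGreedyWord_range' m
  | tail _ hs ih => exact ih.step hs

theorem IsGreedyWord.length_le (h : IsGreedyWord m w) : w.length ≤ (m + 1).factorial + m :=
  Nat.sub_le_iff_le_add.1 (card_perms (m + 1) ▸ h.isGreedyWalk.length_le_card)

theorem IsGreedyWord.exhausts (h : IsGreedyWord m w) (hs : ¬ ∃ w', Step (m + 1) w w') :
    patternGraph.Exhausts (perms (m + 1)) (pattern (m + 1) w) (w.length - m)
      (pattern m w (w.length - m)) := by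
  classical
  intro p hp hsrc
  obtain ⟨v, hv, i, h1, h2, rfl⟩ := exists_eq_append hp
  obtain rfl : v = _ := (src_append hv i).symm.trans hsrc
  rw [← covers_extension_iff (nodup_of_mem_perms h.mem_perms) h.le_length h1 h2]
  by_contra hc
  have hex : ∃ i, 1 ≤ i ∧ i ≤ m + 1 ∧ ¬ Covers (m + 1) w (extension (w.rtake m) i) :=
    ⟨i, h1, h2, hc⟩
  exact hs ⟨_, Nat.find hex, ⟨Nat.find_spec hex, fun j hj => Nat.find_min' hex hj⟩, rfl⟩

theorem length_of_step (h : Step n w w') : w'.length = w.length + 1 := by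
  obtain ⟨i, -, rfl⟩ := h
  exact length_append _ _

theorem step_rightUnique (n : ℕ) : Relator.RightUnique (Step n) := by
  rintro w a b ⟨i, hi, rfl⟩ ⟨j, hj, rfl⟩
  rw [hi.unique hj]

theorem exists_isOutput_of_reflTransGen {w : List ℕ}
    (h : Relation.ReflTransGen (Step (m + 1)) (List.range' 1 m) w) :
    ∃ w', IsOutput (m + 1) w' := by
  by_cases hs : ∃ w', Step (m + 1) w w'
  · obtain ⟨w', hw'⟩ := hs
    have := length_of_step hw'
    have := (isGreedyWord_of_reflTransGen (h.tail hw')).length_le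
    exact exists_isOutput_of_reflTransGen (h.tail hw')
  · exact ⟨w, h, hs⟩
termination_by (m + 1).factorial + m - w.length

theorem IsOutput.unique (hw : IsOutput n w) (hw' : IsOutput n w') : w = w' := by
  have hstuck {u v : List ℕ} (hu : ¬ ∃ u', Step n u u')
      (huv : Relation.ReflTransGen (Step n) u v) : u = v :=
    huv.cases_head.resolve_right fun ⟨c, hc, _⟩ => hu ⟨c, hc⟩
  obtain h | h := Relation.ReflTransGen.total_of_right_unique (step_rightUnique n) hw.1 hw'.1
  · exact hstuck hw.2 h
  · exact (hstuck hw'.2 h).symm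

theorem existsUnique_isOutput (m : ℕ) : ∃! w, IsOutput (m + 1) w := by
  obtain ⟨w, hw⟩ := exists_isOutput_of_reflTransGen (m := m) .refl
  exact ⟨w, hw, fun w' hw' => hw'.unique hw⟩

end GreedyWord

section SpecialPatterns

variable {m b : ℕ} {l p v : List ℕ}

theorem map_shift_of_forall_lt (h : ∀ x ∈ l, x < b) : l.map (shift b) = l :=
  (List.map_congr_left fun x hx => if_pos (h x hx)).trans (List.map_id l)

theorem map_shift_of_forall_le (h : ∀ x ∈ l, b ≤ x) : l.map (shift b) = l.map (1 + ·) :=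
  List.map_congr_left fun x hx => (if_neg (h x hx).not_gt).trans (Nat.add_comm x 1)

theorem append_max (hv : v ∈ perms m) : append v (m + 1) = v ++ [m + 1] := by
  rw [append, map_shift_of_forall_lt fun x hx =>
    Nat.lt_succ_of_le ((mem_iff_of_mem_perms hv).1 hx).2]

theorem range'_notMem_maxBeforeMin (hm : 1 ≤ m) : List.range' 1 m ∉ maxBeforeMin m := fun h => by
  have hsorted : (List.range' 1 m).Pairwise (· < ·) := List.pairwise_lt_range'
  exact hm.not_gt (List.pairwise_pair.1 (hsorted.sublist (mem_maxBeforeMin.1 h).2))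

theorem one_cons_notMem_maxBeforeMin : 1 :: l ∉ maxBeforeMin (m + 1) := fun h => by
  obtain ⟨hperm, hsub⟩ := mem_maxBeforeMin.1 h
  have h1 : 1 ∈ l := by
    obtain h | h := pair_sublist_cons_iff.1 hsub
    · exact h.2
    · exact h.subset (by simp)
  exact (List.nodup_cons.1 (nodup_of_mem_perms hperm)).1 h1

theorem range'_concat_one_mem_maxBeforeMin (hm : 2 ≤ m) :
    List.range' 2 (m - 1) ++ [1] ∈ maxBeforeMin m := by
  obtain ⟨m, rfl⟩ := Nat.exists_eq_add_of_le' hm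
  refine mem_maxBeforeMin.2 ⟨mem_perms_of_perm (List.perm_append_singleton 1 _)
    (range'_mem_perms (m + 2)), ?_⟩
  exact pair_sublist_concat_iff.2 (Or.inl ⟨rfl, List.mem_range'_1.2 (by omega)⟩)

theorem append_range'_two (hm : 1 ≤ m) :
    append (List.range' 1 m) 2 = 1 :: (List.range' 3 (m - 1) ++ [2]) := by
  obtain ⟨m, rfl⟩ := Nat.exists_eq_add_of_le' hm
  rw [append, List.range'_succ, List.map_cons,
    map_shift_of_forall_le fun x hx => (List.mem_range'_1.1 hx).1, List.map_add_range']
  rfl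

theorem tgt_append_range'_two (hm : 1 ≤ m) :
    patternGraph.tgt (append (List.range' 1 m) 2) = List.range' 2 (m - 1) ++ [1] := by
  obtain ⟨m, rfl⟩ := Nat.exists_eq_add_of_le' hm
  have hmem : List.range' 2 m ++ [1] ∈ perms (m + 1) :=
    mem_perms_of_perm (List.perm_append_singleton 1 _) (range'_mem_perms (m + 1))
  have hsucc : List.range' 3 m ++ [2] = (List.range' 2 m ++ [1]).map (1 + ·) := by
    rw [List.map_append, List.map_add_range']
    rfl
  rw [append_range'_two hm]
  change red (List.range' 3 m ++ [2]) = List.range' 2 m ++ [1]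
  rw [hsucc, red_map (add_right_strictMono.strictMonoOn _), red_eq_self hmem]

theorem eq_cons_range'_of_tgt_eq (hm : 1 ≤ m) (hp : p ∈ maxBeforeMin (m + 1))
    (htgt : patternGraph.tgt p = List.range' 1 m) : p = (m + 1) :: List.range' 1 m := by
  obtain ⟨x, hx1, hxm, -, heq⟩ := exists_eq_cons_map_shift (maxBeforeMin_subset_perms _ hp)
  rw [htgt] at heq
  rw [heq, cons_map_shift_mem_maxBeforeMin_iff hm (range'_mem_perms m) hx1 hxm] at hp
  obtain rfl := hp.resolve_right fun h => range'_notMem_maxBeforeMin hm h.2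
  rw [heq, map_shift_of_forall_lt fun x hx => Nat.lt_succ_of_le
    ((mem_iff_of_mem_perms (range'_mem_perms m)).1 hx).2]

end SpecialPatterns

namespace IsOutput

variable {m k : ℕ} {w : List ℕ}

theorem isGreedyWord (h : IsOutput (m + 1) w) : IsGreedyWord m w := isGreedyWord_of_reflTransGen h.1

theorem exhausts (h : IsOutput (m + 1) w) :
    patternGraph.Exhausts (perms (m + 1)) (pattern (m + 1) w) (w.length - m)
      (pattern m w (w.length - m)) := h.isGreedyWord.exhausts h.2

theorem isGreedyEulerian_perms (h : IsOutput (m + 1) w) :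
    patternGraph.IsGreedyEulerian (perms (m + 1)) (pattern m w 0) :=
  h.isGreedyWord.pattern_zero ▸ GreedyPerm.isGreedyEulerian_perms m

theorem length_eq (h : IsOutput (m + 1) w) : w.length = (m + 1).factorial + m := by
  rw [← card_perms,
    ← h.isGreedyWord.isGreedyWalk.length_eq_card h.exhausts h.isGreedyEulerian_perms,
    Nat.sub_add_cancel h.isGreedyWord.le_length]

theorem isGreedyWalk (h : IsOutput (m + 1) w) :
    patternGraph.IsGreedyWalk (perms (m + 1)) (pattern (m + 1) w) (pattern m w)
      (m + 1).factorial := by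
  simpa [h.length_eq] using h.isGreedyWord.isGreedyWalk

theorem exists_pattern_eq_iff (h : IsOutput (m + 1) w) {p : List ℕ} :
    (∃ k < (m + 1).factorial, pattern (m + 1) w k = p) ↔ p ∈ perms (m + 1) := by
  have himage := h.isGreedyWord.isGreedyWalk.image_eq h.exhausts h.isGreedyEulerian_perms
  rw [← himage, h.length_eq, Nat.add_sub_cancel, Finset.mem_image]
  simp only [Finset.mem_range]

theorem pattern_half_and_mem_maxBeforeMin_iff (h : IsOutput (m + 1) w) (hm : 1 ≤ m) :
    pattern m w ((m + 1).factorial / 2) = List.range' 1 m ∧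
      ∀ k < (m + 1).factorial,
        pattern (m + 1) w k ∈ maxBeforeMin (m + 1) ↔ k < (m + 1).factorial / 2 := by
  have hstuck := h.exhausts
  rw [h.length_eq, Nat.add_sub_cancel] at hstuck
  rw [← card_maxBeforeMin (by omega), ← h.isGreedyWord.pattern_zero]
  exact h.isGreedyWalk.initial_segment hstuck (maxBeforeMin_subset_perms _)
    (fun q hq p hp hp' => lab_lt_of_mem_maxBeforeMin hm hq hp hp')
    (h.isGreedyWord.pattern_zero ▸ isGreedyEulerian_maxBeforeMin hm)

theorem pattern_half (h : IsOutput (m + 1) w) (hm : 1 ≤ m) :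
    pattern m w ((m + 1).factorial / 2) = List.range' 1 m :=
  (h.pattern_half_and_mem_maxBeforeMin_iff hm).1

theorem pattern_mem_maxBeforeMin_iff (h : IsOutput (m + 1) w) (hm : 1 ≤ m)
    (hk : k < (m + 1).factorial) :
    pattern (m + 1) w k ∈ maxBeforeMin (m + 1) ↔ k < (m + 1).factorial / 2 :=
  (h.pattern_half_and_mem_maxBeforeMin_iff hm).2 k hk

theorem getElem?_half_eq_one (h : IsOutput (m + 1) w) (hm : 1 ≤ m) :
    w[(m + 1).factorial / 2]? = some 1 := by
  have hw := h.isGreedyWord.mem_perms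
  have hlen := h.length_eq
  have hfac := (m + 1).factorial_pos
  obtain ⟨d, hd⟩ := List.mem_iff_getElem?.1 ((mem_iff_of_mem_perms hw).2 (by omega : 1 ≤ 1 ∧ _))
  have hd_lt : d < w.length := (List.getElem?_eq_some_iff.1 hd).1
  obtain ⟨T, hT⟩ : ∃ T, T = (m + 1).factorial / 2 := ⟨_, rfl⟩
  have hmem {k : ℕ} (hk : k < (m + 1).factorial) := hT ▸ h.pattern_mem_maxBeforeMin_iff hm hk
  rw [← hT]
  rcases lt_or_ge d T with hdT | hdT
  · -- The pattern starting at the letter `1` would start with `1`.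
    obtain ⟨l, hl⟩ := List.head?_eq_some_iff.1
      ((List.head?_eq_getElem? ..).trans (getElem?_pattern_eq_one (n := m + 1) (j := 0) hw
        m.succ_pos hd))
    exact absurd ((hmem (by omega)).2 hdT) (hl ▸ one_cons_notMem_maxBeforeMin)
  rcases lt_or_ge d (T + m) with hdm | hdm
  · -- The letter `1` belongs to the factor with pattern `1 2 ⋯ m`, so it is its first letter.
    obtain ⟨j, rfl⟩ := Nat.exists_eq_add_of_le hdT
    have hj := getElem?_pattern_eq_one hw (by omega : j < m) hd
    rw [hT, h.pattern_half hm, List.getElem?_range' (by omega), Option.some_inj] at hj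
    obtain rfl : j = 0 := by omega
    exact hd
  · -- The pattern ending at the letter `1` would end with `1`.
    obtain ⟨k, rfl⟩ := Nat.exists_eq_add_of_le' (le_of_add_le_right hdm)
    have hk : k < (m + 1).factorial := by omega
    have hlast := getElem?_pattern_eq_one hw m.lt_succ_self hd
    obtain ⟨v, hv, i, hi1, him, hp⟩ := exists_eq_append (h.isGreedyWalk.mem k hk)
    rw [hp, append, List.getElem?_append_right (by simp [length_of_mem_perms hv])] at hlast
    obtain rfl : i = 1 := by simpa [length_of_mem_perms hv] using hlast
    have := (hmem hk).1 (hp ▸ (append_mem_maxBeforeMin_iff hm hv hi1 him).2 (Or.inl rfl))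
    omega

theorem pattern_half_sub_one (h : IsOutput (m + 1) w) (hm : 1 ≤ m) :
    pattern (m + 1) w ((m + 1).factorial / 2 - 1) = (m + 1) :: List.range' 1 m := by
  have hfac := Nat.factorial_le (show 2 ≤ m + 1 by omega)
  rw [Nat.factorial_two] at hfac
  refine eq_cons_range'_of_tgt_eq hm ?_ ?_
  · exact (h.pattern_mem_maxBeforeMin_iff hm (by omega)).2 (by omega)
  · rw [tgt_pattern, Nat.sub_add_cancel (by omega), h.pattern_half hm]

theorem pattern_succ_half (h : IsOutput (m + 1) w) (hm : 1 ≤ m) :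
    pattern (m + 1) w ((m + 1).factorial / 2) = append (List.range' 1 m) 2 := by
  have hlt : (m + 1).factorial / 2 < (m + 1).factorial :=
    Nat.div_lt_self (Nat.factorial_pos _) one_lt_two
  have hroot := range'_mem_perms m
  have happend {i : ℕ} (h1 : 1 ≤ i) (h2 : i ≤ m + 1) :
      append (List.range' 1 m) i ∈ maxBeforeMin (m + 1) ↔ i = 1 := by
    rw [append_mem_maxBeforeMin_iff hm hroot h1 h2]
    exact or_iff_left fun h => range'_notMem_maxBeforeMin hm h.2
  obtain ⟨v, hv, i, hi1, him, hp⟩ := exists_eq_append (h.isGreedyWalk.mem _ hlt)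
  have hsrc := h.isGreedyWalk.src_eq _ hlt
  rw [h.pattern_half hm] at hsrc
  obtain rfl : v = List.range' 1 m := by rwa [hp, src_append hv] at hsrc
  have hi_ne : i ≠ 1 := fun hi => lt_irrefl _ <|
    (h.pattern_mem_maxBeforeMin_iff hm hlt).1 (hp ▸ (happend hi1 him).2 hi)
  -- A label larger than `2` would mean that the edge labelled `2` has been used before.
  have hi_le : i ≤ 2 := by
    by_contra! hi
    obtain ⟨j, hj, heq⟩ := h.isGreedyWalk.greedy _ hlt _
      (append_mem_perms hroot one_le_two (by omega))
      ((src_append hroot 2).trans (h.pattern_half hm).symm) (by rwa [hp, lab_append, lab_append])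
    have hmem := (h.pattern_mem_maxBeforeMin_iff hm (hj.trans hlt)).2 hj
    exact absurd ((happend one_le_two (by omega)).1 (heq ▸ hmem)) (by norm_num)
  rw [hp, show i = 2 by omega]

theorem pattern_succ_succ_half (h : IsOutput (m + 1) w) (hm : 2 ≤ m) :
    pattern (m + 1) w ((m + 1).factorial / 2 + 1) = List.range' 2 (m - 1) ++ [1, m + 1] := by
  have hfac := Nat.factorial_le (show 3 ≤ m + 1 by omega)
  rw [show Nat.factorial 3 = 6 by rfl] at hfac
  have hlt : (m + 1).factorial / 2 + 1 < (m + 1).factorial := by omega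
  obtain ⟨v, hv, i, hi1, him, hp⟩ := exists_eq_append (h.isGreedyWalk.mem _ hlt)
  have hsrc := h.isGreedyWalk.src_eq _ hlt
  rw [hp, src_append hv, ← tgt_pattern m w ((m + 1).factorial / 2), h.pattern_succ_half (by omega),
    tgt_append_range'_two (by omega)] at hsrc
  have hnot : append v i ∉ maxBeforeMin (m + 1) := fun hmem => by
    have := (h.pattern_mem_maxBeforeMin_iff (by omega) hlt).1 (hp ▸ hmem)
    omega
  obtain rfl : i = m + 1 := by
    by_contra hi
    exact hnot ((append_mem_maxBeforeMin_iff (by omega) hv hi1 him).2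
      (Or.inr ⟨by omega, hsrc ▸ range'_concat_one_mem_maxBeforeMin hm⟩))
  rw [hp, append_max hv, hsrc, List.append_assoc]
  rfl

theorem setOf_sigma_first_half (h : IsOutput (m + 1) w) (hm : 1 ≤ m) :
    {p | ∃ k, 1 ≤ k ∧ k ≤ (m + 1).factorial / 2 ∧ sigma (m + 1) w k = p} =
      permsBefore (m + 1) (m + 1) 1 := by
  rw [permsBefore_max_one (by omega)]
  ext p
  constructor
  · rintro ⟨k, hk1, hk, rfl⟩
    exact (h.pattern_mem_maxBeforeMin_iff hm (by omega)).2 (by omega)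
  · intro hp
    obtain ⟨k, hk, rfl⟩ := h.exists_pattern_eq_iff.2 (maxBeforeMin_subset_perms _ hp)
    have := (h.pattern_mem_maxBeforeMin_iff hm hk).1 hp
    exact ⟨k + 1, by omega, by omega, rfl⟩

theorem setOf_sigma_second_half (h : IsOutput (m + 1) w) (hm : 1 ≤ m) :
    {p | ∃ k, (m + 1).factorial / 2 < k ∧ k ≤ (m + 1).factorial ∧ sigma (m + 1) w k = p} =
      permsBefore (m + 1) 1 (m + 1) := by
  rw [permsBefore_one_max (by omega)]
  ext p
  constructor
  · rintro ⟨k, hk1, hk, rfl⟩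
    have hk_lt : k - 1 < (m + 1).factorial := by omega
    refine ⟨h.exists_pattern_eq_iff.1 ⟨k - 1, hk_lt, rfl⟩, fun hp => ?_⟩
    have := (h.pattern_mem_maxBeforeMin_iff hm hk_lt).1 hp
    omega
  · rintro ⟨hp, hp'⟩
    obtain ⟨k, hk, rfl⟩ := h.exists_pattern_eq_iff.2 hp
    have := (h.pattern_mem_maxBeforeMin_iff hm hk).not.1 hp'
    exact ⟨k + 1, by omega, by omega, rfl⟩

end IsOutput

end GreedyPerm

theorem mainTheorem4 (n : ℕ) (hn : 2 ≤ n) :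
    (∃! w, GreedyPerm.IsOutput n w) ∧
    ∀ w, GreedyPerm.IsOutput n w →
      w.length = n.factorial + n - 1 ∧
      GreedyPerm.letter w (n.factorial / 2 + 1) = some 1 ∧
      GreedyPerm.sigma n w (n.factorial / 2) = n :: List.range' 1 (n - 1) ∧
      GreedyPerm.sigma n w (n.factorial / 2 + 1) = 1 :: (List.range' 3 (n - 2) ++ [2]) ∧
      (3 ≤ n → GreedyPerm.sigma n w (n.factorial / 2 + 2) = List.range' 2 (n - 2) ++ [1, n]) ∧
      {p | ∃ k, 1 ≤ k ∧ k ≤ n.factorial / 2 ∧ GreedyPerm.sigma n w k = p} =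
        GreedyPerm.permsBefore n n 1 ∧
      {p | ∃ k, n.factorial / 2 < k ∧ k ≤ n.factorial ∧ GreedyPerm.sigma n w k = p} =
        GreedyPerm.permsBefore n 1 n := by
  obtain ⟨m, rfl⟩ := Nat.exists_eq_succ_of_ne_zero (Nat.ne_zero_of_lt hn)
  have hm : 1 ≤ m := Nat.le_of_succ_le_succ hn
  refine ⟨GreedyPerm.existsUnique_isOutput m, fun w hw => ⟨?_, ?_, ?_, ?_, fun h3 => ?_, ?_, ?_⟩⟩
  · exact hw.length_eq
  · exact hw.getElem?_half_eq_one hm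
  · exact hw.pattern_half_sub_one hm
  · exact (hw.pattern_succ_half hm).trans (GreedyPerm.append_range'_two hm)
  · exact hw.pattern_succ_succ_half (Nat.le_of_succ_le_succ h3)
  · exact hw.setOf_sigma_first_half hm
  · exact hw.setOf_sigma_second_half hm
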